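/- Let $\mathfrak z=\{-1,0,1\}\subset\mathbb Z$ and let $\mathcal S(\mathfrak z)=\operatorname{span}\{u_{-1},u_0,u_1\}\subset C^*(\mathbb Z)=C(\mathbb T)$, $u_k=z^k$, be the associated group operator system. A surjective unital completely positive (ucp) map $\varphi:\mathcal S\to\mathcal T$ of operator systems is called a complete quotient map if the induced map $\mathcal S/\ker\varphi\to\mathcal T$ is a complete order isomorphism, where $\dot X\in M_n(\mathcal S/\ker\varphi)$ is positive iff for every $\varepsilon>0$ there is $Y_\varepsilon\in M_n(\mathcal S)_+$ with $\dot Y_\varepsilon=\dot X+\varepsilon \dot I_n$. For a discrete group $G$ with a symmetric generating set $\mathfrak g\ni e$, an action $\alpha$ of $G$ on an operator system $\mathcal S$ by unital complete order automorphisms, and an $\alpha$-admissible $C^*$-cover $(\mathcal C,\rho,\overline\alpha)$ (a unital complete order embedding $\rho:\mathcal S\to\mathcal C$ with $C^*(\rho(\mathcal S))=\mathcal C$, and an action $\overline\alpha$ of $G$ on $\mathcal C$ with $\overline\alpha_g\circ\rho=\rho\circ\alpha_g$), the reduced crossed product is the operator system $\mathcal S\rtimes_{\alpha,\lambda}\mathfrak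 g=\operatorname{span}\{\rho(s)\lambda_g: s\in\mathcal S,\ g\in\mathfrak g\}\subset\mathcal C\rtimes_{\overline\alpha,\lambda}G$. Let $\mathbb Z$ act trivially on $M_2=M_2(\mathbb C)$ and on $\mathcal S(\mathfrak z)$. There is a ($\mathbb Z$-equivariant) complete quotient map $\varphi:M_2\to\mathcal S(\mathfrak z)$ such that, whichever admissible $C^*$-covers of $M_2$ and $\mathcal S(\mathfrak z)$ are used to form the reduced crossed products (in particular for the $C^*$-envelopes), the induced map $$M_2\rtimes_{\mathrm{id},\lambda}\mathfrak z\to\mathcal S(\mathfrak z)\rtimes_{\mathrm{id},\lambda}\mathfrak z,\qquad a\lambda_g\mapsto\varphi(a)\lambda_g,$$ is ucp but is not a complete quotient map. -/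

import Mathlib

open scoped ENNReal InnerProductSpace ComplexOrder

universe u v w

/-! ### Operator systems, ucp maps and complete quotient maps -/

/-- Positivity of an element of the C*-algebra `M_n(A)`. -/
def IsPosMatrix {A : Type*} [CStarAlgebra A] {n : ℕ} (X : Matrix (Fin n) (Fin n) A) : Prop :=
  ∃ B : Matrix (Fin n) (Fin n) A, X = B.conjTranspose * B

/-- An operator system in the unital C*-algebra `A`: a unital self-adjoint subspace. -/
structure OpSystem (A : Type u) [CStarAlgebra A] where
  space : Submodule ℂ A
  one_mem : (1 : A) ∈ space
  star_mem : ∀ a ∈ space, star a ∈ space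

namespace OpSystem

instance {A : Type u} [CStarAlgebra A] : CoeSort (OpSystem A) (Type u) := ⟨fun S => S.space⟩

/-- A unital C*-algebra as an operator system. -/
noncomputable def whole (A : Type u) [CStarAlgebra A] : OpSystem A where
  space := ⊤
  one_mem := Submodule.mem_top
  star_mem := fun _ _ => Submodule.mem_top

variable {A : Type u} [CStarAlgebra A] {B : Type v} [CStarAlgebra B]

/-- The order unit of an operator system. -/
def unit (S : OpSystem A) : S := ⟨1, S.one_mem⟩

/-- The cone `M_n(S)₊ = M_n(S) ∩ M_n(A)₊`. -/
def IsPos (S : OpSystem A) {n : ℕ} (X : Matrix (Fin n) (Fin n) S) : Prop :=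
  IsPosMatrix (X.map (fun s => (s : A)))

/-- Unital completely positive maps. -/
structure IsUCP {S : OpSystem A} {T : OpSystem B} (φ : S →ₗ[ℂ] T) : Prop where
  map_unit : φ S.unit = T.unit
  map_pos : ∀ (n : ℕ) (X : Matrix (Fin n) (Fin n) S), S.IsPos X → T.IsPos (X.map φ)

/-- The cone of `M_n(S / ker φ)`: the class `X` is positive iff for every `ε > 0` the matrix
`X + ε I_n` lifts to an element of `M_n(S)₊`. -/
def IsQuotientPos {S : OpSystem A} {T : OpSystem B} (φ : S →ₗ[ℂ] T) {n : ℕ}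
    (X : Matrix (Fin n) (Fin n) (S ⧸ LinearMap.ker φ)) : Prop :=
  ∀ ε : ℝ, 0 < ε → ∃ Y : Matrix (Fin n) (Fin n) S, S.IsPos Y ∧
    Y.map (LinearMap.ker φ).mkQ =
      X + (ε : ℂ) • Matrix.diagonal (fun _ => (LinearMap.ker φ).mkQ S.unit)

/-- A surjective ucp map `φ : S → T` is a complete quotient map if the induced (bijective) map
`S / ker φ → T` is a complete order isomorphism. -/
structure IsCompleteQuotientMap {S : OpSystem A} {T : OpSystem B} (φ : S →ₗ[ℂ] T) : Prop where
  ucp : IsUCP φ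
  surjective : Function.Surjective φ
  order_iso : ∀ (n : ℕ) (X : Matrix (Fin n) (Fin n) (S ⧸ LinearMap.ker φ)),
    IsQuotientPos φ X ↔ T.IsPos (X.map ((LinearMap.ker φ).liftQ φ le_rfl))

theorem IsUCP.id (S : OpSystem A) : IsUCP (LinearMap.id : S →ₗ[ℂ] S) :=
  ⟨rfl, fun _ _ h => h⟩

theorem IsUCP.comp {C : Type w} [CStarAlgebra C] {S : OpSystem A} {T : OpSystem B}
    {R : OpSystem C} {ψ : T →ₗ[ℂ] R} {φ : S →ₗ[ℂ] T} (hψ : IsUCP ψ) (hφ : IsUCP φ) :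
    IsUCP (ψ ∘ₗ φ) :=
  ⟨by simp [hφ.map_unit, hψ.map_unit], fun n X h => hψ.map_pos n _ (hφ.map_pos n X h)⟩

/-- `Aut(S)`: the group of unital complete order isomorphisms of `S`. -/
def Aut (S : OpSystem A) : Subgroup (S ≃ₗ[ℂ] S) where
  carrier := {φ | IsUCP φ.toLinearMap ∧ IsUCP φ.symm.toLinearMap}
  one_mem' := ⟨IsUCP.id S, IsUCP.id S⟩
  mul_mem' := fun {_ _} ha hb => ⟨ha.1.comp hb.1, hb.2.comp ha.2⟩
  inv_mem' := fun {_} ha => ⟨ha.2, ha.1⟩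

/-- `G`-equivariance of a map between operator systems with actions `α` and `β` of `G`. -/
def IsEquivariant {G : Type*} [Group G] {S : OpSystem A} {T : OpSystem B}
    (α : G →* S.Aut) (β : G →* T.Aut) (φ : S →ₗ[ℂ] T) : Prop :=
  ∀ (g : G) (s : S), (β g : T ≃ₗ[ℂ] T) (φ s) = φ ((α g : S ≃ₗ[ℂ] S) s)

end OpSystem

/-! ### Admissible C*-covers and reduced crossed products -/

/-- The standing assumptions on the generating set `𝔤` of a discrete group. -/
structure IsGeneratingSet {G : Type*} [Group G] (𝔤 : Set G) : Prop where
  one_mem : 1 ∈ 𝔤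
  inv_mem : ∀ g ∈ 𝔤, g⁻¹ ∈ 𝔤
  closure_eq : Subgroup.closure 𝔤 = ⊤

/-- An `α`-admissible C*-cover `(C, ρ)` of `S`: a unital complete order embedding `ρ : S → C`
whose range generates `C`, and an action of `G` on `C` extending `α`. -/
structure AdmissibleCover {A : Type u} [CStarAlgebra A] (S : OpSystem A)
    {G : Type*} [Group G] (α : G →* S.Aut) (C : Type v) [CStarAlgebra C] where
  ρ : S →ₗ[ℂ] C
  map_unit : ρ S.unit = 1
  map_star : ∀ s : S, ρ ⟨star (s : A), S.star_mem s s.2⟩ = star (ρ s)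
  injective : Function.Injective ρ
  pos_iff : ∀ (n : ℕ) (X : Matrix (Fin n) (Fin n) S), IsPosMatrix (X.map ρ) ↔ S.IsPos X
  generates : (StarAlgebra.adjoin ℂ (Set.range ρ)).topologicalClosure = ⊤
  act : G →* (C ≃⋆ₐ[ℂ] C)
  act_apply : ∀ (g : G) (s : S), act g (ρ s) = ρ ((α g : S ≃ₗ[ℂ] S) s)

/-- A faithful unital representation of `C` on the Hilbert space `H`. -/
structure FaithfulRep (C : Type v) [CStarAlgebra C] (H : Type w) [NormedAddCommGroup H]
    [InnerProductSpace ℂ H] [CompleteSpace H] where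
  toHom : C →⋆ₐ[ℂ] (H →L[ℂ] H)
  injective : Function.Injective toHom

/-- The Hilbert space `ℓ²(G, H)`. -/
abbrev EllTwo (G : Type*) (H : Type*) [NormedAddCommGroup H] : Type _ := lp (fun _ : G => H) 2

theorem EllTwo.hasSum_sq {G : Type*} {H : Type*} [NormedAddCommGroup H] (ξ : EllTwo G H) : HasSum (fun h => ‖ξ h‖ ^ 2) (‖ξ‖ ^ 2) := by
  have := lp.hasSum_norm (p := 2) (by norm_num) ξ
  simpa using this

theorem EllTwo.weightedPerm_le {G : Type*} {H : Type*} [NormedAddCommGroup H]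
    [InnerProductSpace ℂ H] (a : G → H →L[ℂ] H) (c : ℝ) (ha : ∀ h, ‖a h‖ ≤ c)
    (e : Equiv.Perm G) (ξ : EllTwo G H) (h : G) :
    ‖a h (ξ (e h))‖ ^ 2 ≤ c ^ 2 * ‖ξ (e h)‖ ^ 2 := by
  rw [← mul_pow]
  exact pow_le_pow_left₀ (norm_nonneg _) ((a h).le_of_opNorm_le (ha h) _) 2

theorem EllTwo.weightedPerm_hasSum {G : Type*} {H : Type*} [NormedAddCommGroup H]
    (c : ℝ) (e : Equiv.Perm G) (ξ : EllTwo G H) :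
    HasSum (fun h => c ^ 2 * ‖ξ (e h)‖ ^ 2) (c ^ 2 * ‖ξ‖ ^ 2) :=
  ((e.hasSum_iff (f := fun h => ‖ξ h‖ ^ 2)).2 (EllTwo.hasSum_sq ξ)).mul_left _

theorem EllTwo.weightedPerm_mem {G : Type*} {H : Type*} [NormedAddCommGroup H]
    [InnerProductSpace ℂ H] (a : G → H →L[ℂ] H) (c : ℝ) (ha : ∀ h, ‖a h‖ ≤ c)
    (e : Equiv.Perm G) (ξ : EllTwo G H) : Memℓp (fun h => a h (ξ (e h))) 2 :=
  memℓp_gen (by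
    simpa using Summable.of_nonneg_of_le (fun _ => by positivity)
      (EllTwo.weightedPerm_le a c ha e ξ) (EllTwo.weightedPerm_hasSum c e ξ).summable)

/-- The operator `(T ξ)(h) = a_h (ξ (e h))` on `ℓ²(G, H)`, as a linear map. -/
noncomputable def EllTwo.weightedPermLin {G : Type*} {H : Type*} [NormedAddCommGroup H]
    [InnerProductSpace ℂ H] (a : G → H →L[ℂ] H) (c : ℝ) (ha : ∀ h, ‖a h‖ ≤ c)
    (e : Equiv.Perm G) : EllTwo G H →ₗ[ℂ] EllTwo G H where
  toFun ξ := ⟨fun h => a h (ξ (e h)), EllTwo.weightedPerm_mem a c ha e ξ⟩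
  map_add' ξ η := by
    apply lp.ext
    funext h
    exact (a h).map_add (ξ (e h)) (η (e h))
  map_smul' r ξ := by
    apply lp.ext
    funext h
    exact (a h).map_smul r (ξ (e h))

theorem EllTwo.weightedPermLin_norm_le {G : Type*} {H : Type*} [NormedAddCommGroup H]
    [InnerProductSpace ℂ H] (a : G → H →L[ℂ] H) (c : ℝ) (ha : ∀ h, ‖a h‖ ≤ c)
    (e : Equiv.Perm G) (ξ : EllTwo G H) :
    ‖EllTwo.weightedPermLin a c ha e ξ‖ ≤ |c| * ‖ξ‖ := by
  refine (sq_le_sq₀ (norm_nonneg _) (by positivity)).1 ?_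
  rw [mul_pow, sq_abs]
  exact hasSum_le (EllTwo.weightedPerm_le a c ha e ξ)
    (EllTwo.hasSum_sq (EllTwo.weightedPermLin a c ha e ξ)) (EllTwo.weightedPerm_hasSum c e ξ)

/-- The operator `(T ξ)(h) = a_h (ξ (e h))` on `ℓ²(G, H)`, for a family of operators `a_h` with
`‖a_h‖ ≤ c` and a permutation `e` of `G`. -/
noncomputable def EllTwo.weightedPerm {G : Type*} {H : Type*} [NormedAddCommGroup H]
    [InnerProductSpace ℂ H] (a : G → H →L[ℂ] H) (c : ℝ) (ha : ∀ h, ‖a h‖ ≤ c)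
    (e : Equiv.Perm G) : EllTwo G H →L[ℂ] EllTwo G H :=
  (EllTwo.weightedPermLin a c ha e).mkContinuous |c| (EllTwo.weightedPermLin_norm_le a c ha e)

@[simp]
theorem EllTwo.weightedPerm_apply {G : Type*} {H : Type*} [NormedAddCommGroup H]
    [InnerProductSpace ℂ H] (a : G → H →L[ℂ] H) (c : ℝ) (ha : ∀ h, ‖a h‖ ≤ c)
    (e : Equiv.Perm G) (ξ : EllTwo G H) (h : G) :
    EllTwo.weightedPerm a c ha e ξ h = a h (ξ (e h)) := rfl

namespace AdmissibleCover

open OpSystem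

variable {A : Type*} [CStarAlgebra A] {S : OpSystem A} {G : Type*} [Group G] {α : G →* S.Aut}
  {C : Type*} [CStarAlgebra C] {H : Type*} [NormedAddCommGroup H] [InnerProductSpace ℂ H]
  [CompleteSpace H]

/-- The left translation `(λ_g ξ)(h) = ξ(g⁻¹ h)` on `ℓ²(G, H)`. -/
noncomputable def translation (H : Type*) [NormedAddCommGroup H] [InnerProductSpace ℂ H]
    {G : Type*} [Group G] (g : G) : EllTwo G H →L[ℂ] EllTwo G H :=
  EllTwo.weightedPerm (fun _ => ContinuousLinearMap.id ℂ H) 1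
    (fun _ => ContinuousLinearMap.norm_id_le) (Equiv.mulLeft g⁻¹)

theorem translation_apply {H : Type*} [NormedAddCommGroup H] [InnerProductSpace ℂ H]
    {G : Type*} [Group G] (g : G) (ξ : EllTwo G H) (h : G) :
    translation H g ξ h = ξ (g⁻¹ * h) := rfl

/-- The representation `(a ξ)(h) = π(α_h⁻¹(a)) ξ(h)` of `C` on `ℓ²(G, H)`. -/
noncomputable def regRep (𝒞 : AdmissibleCover S α C) (π : FaithfulRep C H) (a : C) :
    EllTwo G H →L[ℂ] EllTwo G H :=
  EllTwo.weightedPerm (fun h => π.toHom (𝒞.act h⁻¹ a)) ‖a‖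
    (fun h => (NonUnitalStarAlgHom.norm_apply_le π.toHom _).trans
      (NonUnitalStarAlgHom.norm_apply_le (𝒞.act h⁻¹) a)) (Equiv.refl G)

theorem regRep_apply (𝒞 : AdmissibleCover S α C) (π : FaithfulRep C H) (a : C)
    (ξ : EllTwo G H) (h : G) : 𝒞.regRep π a ξ h = π.toHom (𝒞.act h⁻¹ a) (ξ h) := rfl

/-- The element `s λ_g` of `C ⋊_λ G ⊆ B(ℓ²(G, H))`. -/
noncomputable def elem (𝒞 : AdmissibleCover S α C) (π : FaithfulRep C H) (s : S) (g : G) :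
    EllTwo G H →L[ℂ] EllTwo G H :=
  𝒞.regRep π (𝒞.ρ s) * translation H g

theorem elem_apply (𝒞 : AdmissibleCover S α C) (π : FaithfulRep C H) (s : S) (g : G)
    (ξ : EllTwo G H) (h : G) :
    𝒞.elem π s g ξ h = π.toHom (𝒞.ρ ((α h⁻¹ : S ≃ₗ[ℂ] S) s)) (ξ (g⁻¹ * h)) := by
  rw [← 𝒞.act_apply]; rfl

theorem rho_star (𝒞 : AdmissibleCover S α C) (s : S) (g : G) :
    𝒞.ρ ((α g : S ≃ₗ[ℂ] S) ⟨star (s : A), S.star_mem s s.2⟩) =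
      star (𝒞.ρ ((α g : S ≃ₗ[ℂ] S) s)) := by
  rw [← 𝒞.act_apply, 𝒞.map_star, StarHomClass.map_star, 𝒞.act_apply]

theorem star_elem (𝒞 : AdmissibleCover S α C) (π : FaithfulRep C H) (s : S) (g : G) :
    star (𝒞.elem π s g) =
      𝒞.elem π ((α g⁻¹ : S ≃ₗ[ℂ] S) ⟨star (s : A), S.star_mem s s.2⟩) g⁻¹ := by
  rw [ContinuousLinearMap.star_eq_adjoint, eq_comm, ContinuousLinearMap.eq_adjoint_iff]
  intro ξ η
  rw [lp.inner_eq_tsum, lp.inner_eq_tsum,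
    ← (Equiv.mulLeft g).tsum_eq (fun h => ⟪ξ h, 𝒞.elem π s g η h⟫_ℂ)]
  refine tsum_congr fun h => ?_
  have h1 : (α h⁻¹ : S ≃ₗ[ℂ] S) ((α g⁻¹ : S ≃ₗ[ℂ] S) ⟨star (s : A), S.star_mem s s.2⟩) =
      (α (g * h)⁻¹ : S ≃ₗ[ℂ] S) ⟨star (s : A), S.star_mem s s.2⟩ := by
    rw [mul_inv_rev, map_mul]; rfl
  rw [elem_apply, elem_apply, h1, rho_star]
  rw [StarHomClass.map_star π.toHom, ContinuousLinearMap.star_eq_adjoint, ContinuousLinearMap.adjoint_inner_left]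
  simp

/-- `s ↦ s λ_g` as a linear map. -/
noncomputable def elemLin (𝒞 : AdmissibleCover S α C) (π : FaithfulRep C H) (g : G) :
    S →ₗ[ℂ] (EllTwo G H →L[ℂ] EllTwo G H) where
  toFun s := 𝒞.elem π s g
  map_add' s t := by
    ext ξ h
    rw [elem_apply, map_add, map_add, map_add, add_apply,
      add_apply, lp.coeFn_add, Pi.add_apply, elem_apply, elem_apply]
  map_smul' r s := by
    ext ξ h
    rw [elem_apply, map_smul, map_smul, map_smul, smul_apply,
      RingHom.id_apply, smul_apply, lp.coeFn_smul, Pi.smul_apply, elem_apply]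

/-- The reduced crossed product `S ⋊_{α,λ} 𝔤 = span {s λ_g : s ∈ S, g ∈ 𝔤} ⊆ C ⋊_λ G`, where
`C ⋊_λ G` is realised in `B(ℓ²(G, H))` by means of a faithful representation `π` of `C` on `H`
(as `C ⋊_λ G` is a unital C*-subalgebra, its matrix cones are those of `B(ℓ²(G, H))`). The
C*-envelope of `S` with the extended action is one of the admissible covers `C`. -/
noncomputable def crossedProduct (𝒞 : AdmissibleCover S α C) (π : FaithfulRep C H)
    {𝔤 : Set G} (h𝔤 : IsGeneratingSet 𝔤) : OpSystem (EllTwo G H →L[ℂ] EllTwo G H) where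
  space := Submodule.span ℂ {T | ∃ s : S, ∃ g ∈ 𝔤, T = 𝒞.elem π s g}
  one_mem := by
    refine Submodule.subset_span ⟨S.unit, 1, h𝔤.one_mem, ?_⟩
    ext ξ h
    rw [elem_apply, ← 𝒞.act_apply, 𝒞.map_unit]
    simp
  star_mem := by
    intro T hT
    induction hT using Submodule.span_induction with
    | mem T hT =>
      obtain ⟨s, g, hg, rfl⟩ := hT
      exact Submodule.subset_span ⟨_, g⁻¹, h𝔤.inv_mem g hg, 𝒞.star_elem π s g⟩
    | zero => simp
    | add T U _ _ hT hU => rw [star_add]; exact add_mem hT hU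
    | smul r T _ hT => rw [star_smul]; exact Submodule.smul_mem _ _ hT

/-- The map `(s_g)_{g ∈ 𝔤} ↦ ∑ s_g λ_g` on finitely supported families. -/
noncomputable def sumMap (𝒞 : AdmissibleCover S α C) (π : FaithfulRep C H) (𝔤 : Set G) :
    (𝔤 →₀ S) →ₗ[ℂ] (EllTwo G H →L[ℂ] EllTwo G H) :=
  Finsupp.lsum ℂ (fun g => 𝒞.elemLin π g)

theorem sumMap_single (𝒞 : AdmissibleCover S α C) (π : FaithfulRep C H) (𝔤 : Set G) (g : 𝔤)
    (s : S) : 𝒞.sumMap π 𝔤 (Finsupp.single g s) = 𝒞.elem π s g := by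
  rw [sumMap, Finsupp.lsum_single]
  rfl

theorem range_sumMap (𝒞 : AdmissibleCover S α C) (π : FaithfulRep C H) {𝔤 : Set G}
    (h𝔤 : IsGeneratingSet 𝔤) :
    LinearMap.range (𝒞.sumMap π 𝔤) = (𝒞.crossedProduct π h𝔤).space := by
  apply le_antisymm
  · rintro _ ⟨f, rfl⟩
    induction f using Finsupp.induction_linear with
    | zero => simp
    | add f g hf hg => rw [map_add]; exact add_mem hf hg
    | single g s =>
      rw [sumMap_single]
      exact Submodule.subset_span ⟨s, g, g.2, rfl⟩
  · refine Submodule.span_le.2 ?_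
    rintro _ ⟨s, g, hg, rfl⟩
    exact ⟨Finsupp.single ⟨g, hg⟩ s, 𝒞.sumMap_single π 𝔤 ⟨g, hg⟩ s⟩

theorem sumMap_apply_single (𝒞 : AdmissibleCover S α C) (π : FaithfulRep C H) (𝔤 : Set G)
    [DecidableEq G] (f : 𝔤 →₀ S) (g : 𝔤) (v : H) :
    𝒞.sumMap π 𝔤 f (lp.single 2 1 v) (g : G) =
      π.toHom (𝒞.ρ ((α (g : G)⁻¹ : S ≃ₗ[ℂ] S) (f g))) v := by
  induction f using Finsupp.induction_linear with
  | zero => simp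
  | add f₁ f₂ h₁ h₂ =>
    rw [map_add, add_apply, lp.coeFn_add, Pi.add_apply, h₁, h₂,
      Finsupp.add_apply, map_add, map_add, map_add, add_apply]
  | single g' s =>
    rw [sumMap_single, elem_apply]
    by_cases hg : g' = g
    · subst hg
      simp
    · have : ((g' : G)⁻¹ * g) ≠ 1 := by
        intro h
        exact hg (Subtype.ext (inv_mul_eq_one.1 h))
      rw [lp.single_apply_ne _ _ _ this, Finsupp.single_eq_of_ne' hg]
      simp

theorem sumMap_injective (𝒞 : AdmissibleCover S α C) (π : FaithfulRep C H) (𝔤 : Set G) :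
    Function.Injective (𝒞.sumMap π 𝔤) := by
  classical
  rw [injective_iff_map_eq_zero]
  intro f hf
  ext1 g
  have h : π.toHom (𝒞.ρ ((α (g : G)⁻¹ : S ≃ₗ[ℂ] S) (f g))) = 0 := by
    ext v
    rw [← sumMap_apply_single, hf]
    simp
  rw [map_eq_zero_iff _ π.injective, map_eq_zero_iff _ 𝒞.injective] at h
  simpa using h

/-- Every element of `S ⋊_{α,λ} 𝔤` is uniquely a finite sum `∑ s_g λ_g`. -/
noncomputable def coeffEquiv (𝒞 : AdmissibleCover S α C) (π : FaithfulRep C H) {𝔤 : Set G}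
    (h𝔤 : IsGeneratingSet 𝔤) : (𝔤 →₀ S) ≃ₗ[ℂ] 𝒞.crossedProduct π h𝔤 :=
  (LinearEquiv.ofInjective (𝒞.sumMap π 𝔤) (𝒞.sumMap_injective π 𝔤)).trans
    (LinearEquiv.ofEq _ _ (𝒞.range_sumMap π h𝔤))

theorem coeffEquiv_single (𝒞 : AdmissibleCover S α C) (π : FaithfulRep C H) {𝔤 : Set G}
    (h𝔤 : IsGeneratingSet 𝔤) (g : 𝔤) (s : S) :
    (𝒞.coeffEquiv π h𝔤 (Finsupp.single g s) : EllTwo G H →L[ℂ] EllTwo G H) =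
      𝒞.elem π s g :=
  𝒞.sumMap_single π 𝔤 g s

/-- The map `S ⋊_{α,λ} 𝔤 → T ⋊_{β,λ} 𝔤`, `s λ_g ↦ φ(s) λ_g`, induced by `φ : S → T`. -/
noncomputable def inducedMap (𝒞 : AdmissibleCover S α C) (π : FaithfulRep C H)
    {B : Type*} [CStarAlgebra B] {T : OpSystem B} {β : G →* T.Aut} {D : Type*} [CStarAlgebra D]
    {K : Type*} [NormedAddCommGroup K] [InnerProductSpace ℂ K] [CompleteSpace K]
    (𝒟 : AdmissibleCover T β D) (τ : FaithfulRep D K) {𝔤 : Set G} (h𝔤 : IsGeneratingSet 𝔤)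
    (φ : S →ₗ[ℂ] T) : 𝒞.crossedProduct π h𝔤 →ₗ[ℂ] 𝒟.crossedProduct τ h𝔤 :=
  (𝒟.coeffEquiv τ h𝔤).toLinearMap ∘ₗ Finsupp.mapRange.linearMap φ ∘ₗ
    (𝒞.coeffEquiv π h𝔤).symm.toLinearMap

theorem inducedMap_elem (𝒞 : AdmissibleCover S α C) (π : FaithfulRep C H)
    {B : Type*} [CStarAlgebra B] {T : OpSystem B} {β : G →* T.Aut} {D : Type*} [CStarAlgebra D]
    {K : Type*} [NormedAddCommGroup K] [InnerProductSpace ℂ K] [CompleteSpace K]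
    (𝒟 : AdmissibleCover T β D) (τ : FaithfulRep D K) {𝔤 : Set G} (h𝔤 : IsGeneratingSet 𝔤)
    (φ : S →ₗ[ℂ] T) (s : S) (g : G) (hg : g ∈ 𝔤) :
    (𝒞.inducedMap π 𝒟 τ h𝔤 φ ⟨𝒞.elem π s g, Submodule.subset_span ⟨s, g, hg, rfl⟩⟩ :
      EllTwo G K →L[ℂ] EllTwo G K) = 𝒟.elem τ (φ s) g := by
  have : (⟨𝒞.elem π s g, Submodule.subset_span ⟨s, g, hg, rfl⟩⟩ : 𝒞.crossedProduct π h𝔤) =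
      𝒞.coeffEquiv π h𝔤 (Finsupp.single ⟨g, hg⟩ s) :=
    Subtype.ext (𝒞.coeffEquiv_single π h𝔤 ⟨g, hg⟩ s).symm
  rw [this]
  simp [inducedMap, coeffEquiv_single]

end AdmissibleCover

/-! ### Group operator systems, and the case of `ℤ` -/

/-- `(A, u)` is the full group C*-algebra of the discrete group `G`: the unitaries `u_g` generate
`A`, and every unitary representation of `G` in a unital C*-algebra factors through `A`. -/
structure IsGroupCStarAlgebra {G : Type*} [Group G] {A : Type u} [CStarAlgebra A]
    (U : G →* unitary A) : Prop where
  generates : (StarAlgebra.adjoin ℂ (Set.range fun g => (U g : A))).topologicalClosure = ⊤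
  lift : ∀ (B : Type v) [CStarAlgebra B] (V : G →* unitary B),
    ∃ f : A →⋆ₐ[ℂ] B, ∀ g, f (U g : A) = V g

/-- The group operator system `S(𝔤) = span {u_g : g ∈ 𝔤}`. -/
noncomputable def groupOpSystem {G : Type*} [Group G] {A : Type u} [CStarAlgebra A]
    (U : G →* unitary A) {𝔤 : Set G} (h𝔤 : IsGeneratingSet 𝔤) : OpSystem A where
  space := Submodule.span ℂ {a | ∃ g ∈ 𝔤, a = U g}
  one_mem := Submodule.subset_span ⟨1, h𝔤.one_mem, by simp⟩
  star_mem := by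
    intro a ha
    induction ha using Submodule.span_induction with
    | mem a ha =>
      obtain ⟨g, hg, rfl⟩ := ha
      exact Submodule.subset_span ⟨g⁻¹, h𝔤.inv_mem g hg, by rw [map_inv]; rfl⟩
    | zero => simp
    | add a b _ _ ha hb => rw [star_add]; exact add_mem ha hb
    | smul r a _ ha => rw [star_smul]; exact Submodule.smul_mem _ _ ha

/-- The coordinate function `z` as a unitary of `C(𝕋)`. -/
noncomputable def circleCoord : unitary C(Circle, ℂ) :=
  ⟨⟨fun z => (z : ℂ), continuous_subtype_val⟩, by
    rw [Unitary.mem_iff]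
    constructor
    · ext z
      change (starRingEnd ℂ) (z : ℂ) * z = 1
      rw [← Circle.coe_inv_eq_conj, ← Circle.coe_mul, inv_mul_cancel, Circle.coe_one]
    · ext z
      change (z : ℂ) * (starRingEnd ℂ) (z : ℂ) = 1
      rw [← Circle.coe_inv_eq_conj, ← Circle.coe_mul, mul_inv_cancel, Circle.coe_one]⟩

/-- The canonical unitaries `u_k = z ^ k` of `C*(ℤ) = C(𝕋)`. -/
noncomputable def circleUnitary : Multiplicative ℤ →* unitary C(Circle, ℂ) :=
  zpowersHom _ circleCoord

theorem circleUnitary_isGroupCStarAlgebra : IsGroupCStarAlgebra.{0, v} circleUnitary where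
  generates := by
    refine ContinuousMap.starSubalgebra_topologicalClosure_eq_top_of_separatesPoints _ ?_
    intro x y hxy
    refine ⟨_, ⟨(circleCoord : C(Circle, ℂ)), StarAlgebra.subset_adjoin ℂ _
      ⟨Multiplicative.ofAdd 1, by simp [circleUnitary]⟩, rfl⟩, ?_⟩
    exact fun h => hxy (Circle.ext h)
  lift := by
    intro B _ V
    set w : unitary B := V (Multiplicative.ofAdd 1) with hw
    have hn : IsStarNormal (w : B) := inferInstance
    let i : C(spectrum ℂ (w : B), Circle) :=
      ⟨fun z => ⟨z, spectrum.subset_circle_of_unitary w.2 z.2⟩, by fun_prop⟩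
    let f : C(Circle, ℂ) →⋆ₐ[ℂ] B :=
      (cfcHom hn).comp (ContinuousMap.compStarAlgHom' ℂ ℂ i)
    have h1 : f (circleCoord : C(Circle, ℂ)) = w := cfcHom_id hn
    refine ⟨f, fun g => ?_⟩
    have h2 : (Unitary.map
          (⟨⟨⟨f, map_one f⟩, map_mul f⟩, map_star f⟩ : C(Circle, ℂ) →⋆* B)).toMonoidHom.comp circleUnitary = V := by
      refine MonoidHom.ext_mint ?_
      apply Subtype.ext
      simpa [circleUnitary] using h1
    exact congrArg Subtype.val (DFunLike.congr_fun h2 g)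

/-- The subset `{-1, 0, 1}` of `ℤ`, written multiplicatively. -/
def zSet : Set (Multiplicative ℤ) :=
  {Multiplicative.ofAdd (-1), Multiplicative.ofAdd 0, Multiplicative.ofAdd 1}

theorem zSet_isGeneratingSet : IsGeneratingSet zSet where
  one_mem := by simp [zSet]
  inv_mem := by
    rintro g (rfl | rfl | rfl) <;> simp [zSet]
  closure_eq := by
    rw [eq_top_iff]
    intro g _
    have h : Multiplicative.ofAdd (1 : ℤ) ∈ Subgroup.closure zSet :=
      Subgroup.subset_closure (by simp [zSet])
    have := Subgroup.zpow_mem _ h g.toAdd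
    rwa [← ofAdd_zsmul, smul_eq_mul, mul_one, ofAdd_toAdd] at this

/-- The operator system `M_2`. -/
noncomputable abbrev MTwo : OpSystem (CStarMatrix (Fin 2) (Fin 2) ℂ) := OpSystem.whole _

/-- The operator system `S({-1, 0, 1}) ⊆ C*(ℤ) = C(𝕋)`. -/
noncomputable abbrev SZ : OpSystem C(Circle, ℂ) :=
  groupOpSystem circleUnitary zSet_isGeneratingSet

/-! ### Positive matrices over C*-algebras -/

/-! The quotient map is `φ(a)(ζ) = ⟨ξ, a ξ⟩` with `ξ = (1, ζ)/√2`, so it is ucp, and its kernel is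
spanned by `E₀₀ - E₁₁`: a lift is free only in how it splits its trace over the diagonal. Lifting a
positive matrix-valued polynomial `A₀ + ζ A₁ + ζ⁻¹ A₁ᴴ` therefore means splitting `A₀ = P + Q` with
`[[P, A₁], [A₁ᴴ, Q]] ≥ 0`, which is Fejér–Riesz in degree one. The definition of the quotient cone
leaves room for an `ε`, and with it the splitting follows by averaging Schur complements
(`Matrix.exists_block_decomposition`).

For a trivial action of `ℤ`, elements of the crossed product are trigonometric polynomials in a
variable `w` with coefficients in `S`, and a matrix over it is positive iff its value at each `w` is
(`AdmissibleCover.isPos_iff_forall_evalAt`). This criterion mentions neither the cover nor the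
representation, so the conclusions hold for every choice; it also shows that the induced map is ucp.

The induced map is not a complete quotient map because the splitting of the trace must itself have
degree one in `w`. Take `[[3, p], [p*, 3]]` with `p = z(w + w⁻¹) + z⁻¹(w - w⁻¹)`. It is positive, as
`|p| ≤ 2√2 < 3`. At `w = ±1` only the `z` part of `p` survives and forces one pair of diagonal
entries of a lift to have sum at least 8; at `w = ±i` only the `z⁻¹` part survives and forces the
complementary pair to have sum at least 8. In degree one the sum of the values at `±1` equals the
sum at `±i`, so these bounds add up to 32 and exceed the available trace, which is 28 when `ε = 1/2`
(`SZ.false_of_quadratic_nonneg`). -/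

theorem StarAlgHom.map_nonneg_iff_of_injective {A B : Type*} [CStarAlgebra A] [PartialOrder A]
    [StarOrderedRing A] [CStarAlgebra B] [PartialOrder B] [StarOrderedRing B] (f : A →⋆ₐ[ℂ] B)
    (hf : Function.Injective f) {a : A} : 0 ≤ f a ↔ 0 ≤ a := by
  refine ⟨fun h => ?_, fun h => map_nonneg f h⟩
  have hsa : IsSelfAdjoint a := hf (by rw [map_star]; exact h.isSelfAdjoint)
  rw [StarOrderedRing.nonneg_iff_spectrum_nonneg (R := ℝ) _ h.isSelfAdjoint,
    hsa.map_spectrum_real _ hf] at h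
  rwa [StarOrderedRing.nonneg_iff_spectrum_nonneg (R := ℝ) _ hsa]

theorem CStarAlgebra.nonneg_iff_exists_star_mul_self {A : Type*} [CStarAlgebra A] [PartialOrder A]
    [StarOrderedRing A] {a : A} : 0 ≤ a ↔ ∃ b, a = star b * b :=
  CStarAlgebra.nonneg_iff_eq_star_mul_self

namespace IsPosMatrix

variable {A : Type*} [CStarAlgebra A] {B : Type*} [CStarAlgebra B] {n : ℕ}

theorem iff_nonneg [PartialOrder A] [StarOrderedRing A] {X : Matrix (Fin n) (Fin n) A} :
    IsPosMatrix X ↔ (0 : CStarMatrix (Fin n) (Fin n) A) ≤ CStarMatrix.ofMatrix X :=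
  (CStarAlgebra.nonneg_iff_exists_star_mul_self (A := CStarMatrix (Fin n) (Fin n) A)).symm

theorem add {X Y : Matrix (Fin n) (Fin n) A} (hX : IsPosMatrix X) (hY : IsPosMatrix Y) :
    IsPosMatrix (X + Y) := by
  let _ := CStarAlgebra.spectralOrder A
  have := CStarAlgebra.spectralOrderedRing A
  rw [iff_nonneg] at *
  exact add_nonneg hX hY

theorem map (f : A →⋆ₐ[ℂ] B) {X : Matrix (Fin n) (Fin n) A} (hX : IsPosMatrix X) :
    IsPosMatrix (X.map f) := by
  obtain ⟨C, rfl⟩ := hX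
  refine ⟨C.map f, ?_⟩
  ext i j
  simp [Matrix.mul_apply, map_star]

/-- The positive cone is closed. This removes the `ε` from the definition of the quotient cone. -/
theorem of_forall_add_smul_one {X : Matrix (Fin n) (Fin n) A}
    (h : ∀ ε : ℝ, 0 < ε → IsPosMatrix (X + (ε : ℂ) • (1 : Matrix (Fin n) (Fin n) A))) :
    IsPosMatrix X := by
  let _ := CStarAlgebra.spectralOrder A
  have := CStarAlgebra.spectralOrderedRing A
  simp only [iff_nonneg] at *
  set Z : CStarMatrix (Fin n) (Fin n) A := CStarMatrix.ofMatrix X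
  have hc : Continuous fun ε : ℝ => Z + (ε : ℂ) • (1 : CStarMatrix (Fin n) (Fin n) A) := by
    fun_prop
  have ht := (hc.tendsto 0).mono_left (nhdsWithin_le_nhds (s := Set.Ioi 0))
  have := CStarAlgebra.isClosed_nonneg.mem_of_tendsto ht
    (Filter.eventually_of_mem self_mem_nhdsWithin fun ε hε => h ε hε)
  simpa using this

/-- Entrywise application of a unital *-homomorphism. -/
noncomputable def mapHom (n : ℕ) (f : A →⋆ₐ[ℂ] B) :
    CStarMatrix (Fin n) (Fin n) A →⋆ₐ[ℂ] CStarMatrix (Fin n) (Fin n) B where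
  toFun M := M.map f
  map_one' := by ext i j; simp [CStarMatrix.one_apply, apply_ite f]
  map_mul' M N := by ext i j; simp [CStarMatrix.mul_apply]
  map_zero' := by ext i j; simp
  map_add' M N := by ext i j; simp
  commutes' r := by
    ext i j
    simp [CStarMatrix.algebraMap_apply, apply_ite f, AlgHomClass.commutes]
  map_star' M := by ext i j; simp [CStarMatrix.star_apply, map_star]

/-- Injective *-homomorphisms preserve spectra, so matrix cones may be computed in any faithful
representation. -/
theorem map_iff (f : A →⋆ₐ[ℂ] B) (hf : Function.Injective f) {X : Matrix (Fin n) (Fin n) A} :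
    IsPosMatrix (X.map f) ↔ IsPosMatrix X := by
  refine ⟨fun h => ?_, map f⟩
  let _ := CStarAlgebra.spectralOrder A
  have := CStarAlgebra.spectralOrderedRing A
  let _ := CStarAlgebra.spectralOrder B
  have := CStarAlgebra.spectralOrderedRing B
  rw [iff_nonneg] at *
  change 0 ≤ mapHom n f (CStarMatrix.ofMatrix X) at h
  exact (StarAlgHom.map_nonneg_iff_of_injective (mapHom n f)
    (CStarMatrix.map_injective hf)).1 h

theorem inner_nonneg {H : Type*} [NormedAddCommGroup H] [InnerProductSpace ℂ H]
    [CompleteSpace H] {X : Matrix (Fin n) (Fin n) (H →L[ℂ] H)} (hX : IsPosMatrix X)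
    (v : Fin n → H) : 0 ≤ ∑ i, ∑ j, ⟪v i, X i j (v j)⟫_ℂ := by
  obtain ⟨C, rfl⟩ := hX
  have : ∑ i, ∑ j, ⟪v i, (C.conjTranspose * C) i j (v j)⟫_ℂ =
      ∑ k, ⟪∑ i, C k i (v i), ∑ j, C k j (v j)⟫_ℂ := by
    simp_rw [Matrix.mul_apply, Matrix.conjTranspose_apply, sum_apply,
      inner_sum, sum_inner, ContinuousLinearMap.mul_def, ContinuousLinearMap.comp_apply,
      ContinuousLinearMap.star_eq_adjoint, ContinuousLinearMap.adjoint_inner_right]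
    rw [Finset.sum_comm_cycle]
    refine Finset.sum_congr rfl fun k _ => ?_
    rw [Finset.sum_comm]
  rw [this]
  refine Finset.sum_nonneg fun k _ => ?_
  rw [inner_self_eq_norm_sq_to_K, ← RCLike.ofReal_pow]
  exact RCLike.ofReal_nonneg.2 (sq_nonneg _)

-- Here `E` plays the role of `H ^ n` with coordinate projections `p i`. The matrix is assembled
-- into one operator `T` on `E`; a factorisation `T = b* b` is then cut back into blocks.
open ContinuousLinearMap in
theorem of_inner_nonneg_aux {E H : Type*} [NormedAddCommGroup H] [InnerProductSpace ℂ H]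
    [CompleteSpace H] [NormedAddCommGroup E] [InnerProductSpace ℂ E] [CompleteSpace E]
    (p : Fin n → E →L[ℂ] H) (hpq : ∀ i j, p i ∘L adjoint (p j) = if i = j then 1 else 0)
    (hsum : ∑ k, adjoint (p k) ∘L p k = 1) {X : Matrix (Fin n) (Fin n) (H →L[ℂ] H)}
    (h : ∀ v : Fin n → H, 0 ≤ ∑ i, ∑ j, ⟪v i, X i j (v j)⟫_ℂ) : IsPosMatrix X := by
  obtain ⟨T, hTdef⟩ : ∃ T : E →L[ℂ] E, T = ∑ i, ∑ j, adjoint (p i) ∘L X i j ∘L p j := ⟨_, rfl⟩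
  have hT : ∀ i j, p i ∘L T ∘L adjoint (p j) = X i j := by
    intro i j
    simp only [hTdef, finsetSum_comp, comp_finsetSum]
    rw [Finset.sum_eq_single i, Finset.sum_eq_single j]
    · have h1 := hpq i i
      have h2 := hpq j j
      simp only [if_true] at h1 h2
      calc _ = (p i ∘L adjoint (p i)) ∘L X i j ∘L (p j ∘L adjoint (p j)) := rfl
        _ = X i j := by rw [h1, h2]; rfl
    · intro k _ hk
      have h2 := hpq k j
      rw [if_neg hk] at h2
      simp only [comp_assoc, h2, comp_zero]
    · simp
    · intro k _ hk
      have h1 := hpq i k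
      rw [if_neg hk.symm] at h1
      refine Finset.sum_eq_zero fun l _ => ?_
      calc _ = (p i ∘L adjoint (p k)) ∘L (X k l ∘L p l ∘L adjoint (p j)) := rfl
        _ = 0 := by rw [h1, zero_comp]
    · simp
  have hpos : 0 ≤ T := by
    rw [nonneg_iff_isPositive, isPositive_iff_complex]
    intro x
    have hx : ⟪x, T x⟫_ℂ = ∑ i, ∑ j, ⟪p i x, X i j (p j x)⟫_ℂ := by
      simp only [hTdef, sum_apply, inner_sum, comp_apply, adjoint_inner_right]
    have h0 := h (fun i => p i x)
    rw [← hx] at h0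
    have h1 : ⟪T x, x⟫_ℂ = ⟪x, T x⟫_ℂ := by
      rw [← inner_conj_symm, Complex.conj_eq_iff_im]
      exact (Complex.nonneg_iff.1 h0).2.symm
    rw [h1]
    have h2 := Complex.nonneg_iff.1 h0
    refine ⟨?_, h2.1⟩
    apply Complex.ext
    · simp
    · simpa using h2.2
  obtain ⟨b, hb⟩ := CStarAlgebra.nonneg_iff_eq_star_mul_self.1 hpos
  refine ⟨Matrix.of fun k j => p k ∘L b ∘L adjoint (p j), ?_⟩
  ext1 i j
  have hstar : ∀ k, star (p k ∘L b ∘L adjoint (p i)) = p i ∘L star b ∘L adjoint (p k) := by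
    intro k
    simp only [star_eq_adjoint, adjoint_comp, adjoint_adjoint, comp_assoc]
  have hmul : ∀ k, (p i ∘L star b ∘L adjoint (p k)) * (p k ∘L b ∘L adjoint (p j)) =
      p i ∘L star b ∘L (adjoint (p k) ∘L p k) ∘L b ∘L adjoint (p j) := fun k => rfl
  rw [← hT, hb, Matrix.mul_apply]
  simp only [Matrix.conjTranspose_apply, Matrix.of_apply, hstar, hmul]
  rw [← comp_finsetSum, ← comp_finsetSum, ← finsetSum_comp, hsum]
  rfl

open ContinuousLinearMap in
/-- Positivity of operator matrices is positivity of the associated quadratic form. -/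
theorem iff_inner_nonneg {H : Type*} [NormedAddCommGroup H] [InnerProductSpace ℂ H]
    [CompleteSpace H] {X : Matrix (Fin n) (Fin n) (H →L[ℂ] H)} :
    IsPosMatrix X ↔ ∀ v : Fin n → H, 0 ≤ ∑ i, ∑ j, ⟪v i, X i j (v j)⟫_ℂ := by
  refine ⟨inner_nonneg, fun h => ?_⟩
  have hp : ∀ i (v : PiLp 2 (fun _ : Fin n => H)),
      (PiLp.proj 2 (fun _ : Fin n => H) i : _ →L[ℂ] H) v = v i := fun i v => rfl
  have hq : ∀ i v, adjoint (PiLp.proj 2 (fun _ : Fin n => H) i : _ →L[ℂ] H) v =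
      PiLp.single 2 i v := by
    intro i v
    refine ext_inner_right ℂ fun w => ?_
    rw [adjoint_inner_left, PiLp.inner_apply, Finset.sum_eq_single i]
    · simp [hp]
    · intro j _ hj
      simp [hj]
    · simp
  refine of_inner_nonneg_aux (fun i => PiLp.proj 2 (fun _ : Fin n => H) i) ?_ ?_ h
  · intro i j
    ext v
    rw [comp_apply, hq, hp]
    by_cases hij : i = j
    · subst hij; simp
    · simp [hij]
  · ext v i
    simp [sum_apply, hq, hp, Finset.sum_apply, Pi.single_apply]

/-- Positivity in `M_n(M_2)` as positivity of the associated scalar quadratic form. -/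
theorem iff_quadratic_nonneg {X : Matrix (Fin n) (Fin n) (CStarMatrix (Fin 2) (Fin 2) ℂ)} :
    IsPosMatrix X ↔ ∀ v : Fin n → Fin 2 → ℂ,
      0 ≤ ∑ i, ∑ j, ∑ a, ∑ b, star (v i a) * X i j a b * v j b := by
  let f : CStarMatrix (Fin 2) (Fin 2) ℂ →⋆ₐ[ℂ]
      (EuclideanSpace ℂ (Fin 2) →L[ℂ] EuclideanSpace ℂ (Fin 2)) :=
    (StarAlgHomClass.toStarAlgHom (Matrix.toEuclideanCLM (n := Fin 2) (𝕜 := ℂ))).comp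
      ⟨⟨⟨⟨⟨fun M => CStarMatrix.ofMatrix.symm M, rfl⟩, fun _ _ => rfl⟩, rfl, fun _ _ => rfl⟩,
        fun _ => rfl⟩, fun _ => rfl⟩
  have hf : Function.Injective f :=
    (Matrix.toEuclideanCLM (n := Fin 2) (𝕜 := ℂ)).injective.comp
      CStarMatrix.ofMatrix.symm.injective
  have hfa : ∀ (M : CStarMatrix (Fin 2) (Fin 2) ℂ) (x : EuclideanSpace ℂ (Fin 2)) (a : Fin 2),
      f M x a = ∑ b, M a b * x b := fun M x a => rfl
  have key : ∀ v : Fin n → EuclideanSpace ℂ (Fin 2),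
      ∑ i, ∑ j, ⟪v i, X.map f i j (v j)⟫_ℂ =
        ∑ i, ∑ j, ∑ a, ∑ b, star (v i a) * X i j a b * v j b := by
    intro v
    refine Finset.sum_congr rfl fun i _ => Finset.sum_congr rfl fun j _ => ?_
    rw [PiLp.inner_apply]
    refine Finset.sum_congr rfl fun a _ => ?_
    rw [Matrix.map_apply, hfa, inner_sum]
    refine Finset.sum_congr rfl fun b _ => ?_
    simp only [RCLike.inner_apply, starRingEnd_apply]
    ring
  rw [← map_iff f hf, iff_inner_nonneg]
  constructor
  · intro h v
    rw [← key (fun i => WithLp.toLp 2 (v i))]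
    exact h _
  · intro h v
    rw [key v]
    exact h _

end IsPosMatrix

/-! ### Nonnegative trigonometric polynomials -/

/-- The constant coefficient of a nonnegative trigonometric polynomial is nonnegative. -/
theorem Circle.constantCoeff_nonneg {ι : Type*} (s : Finset ι) (m : ι → ℤ) (c : ι → ℂ)
    (h : ∀ w : Circle, 0 ≤ ∑ i ∈ s, (w : ℂ) ^ m i * c i) :
    0 ≤ ∑ i ∈ s, if m i = 0 then c i else 0 := by
  -- Averaging over the `N`-th roots of unity kills every nonconstant term, because `N` exceeds each
  -- `|m i|`.
  obtain ⟨N, hN⟩ : ∃ N : ℕ, N = 1 + ∑ i ∈ s, (m i).natAbs := ⟨_, rfl⟩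
  have hN0 : N ≠ 0 := by omega
  have hω := Complex.isPrimitiveRoot_exp N hN0
  set ω := Complex.exp (2 * Real.pi * Complex.I / N) with hωdef
  have hω1 : ‖ω‖ = 1 := hω.norm'_eq_one hN0
  let W : Circle := ⟨ω, by simpa [Submonoid.unitSphere] using hω1⟩
  have hgeom : ∀ i ∈ s, ∑ k ∈ Finset.range N, (ω ^ k) ^ m i = if m i = 0 then (N : ℂ) else 0 := by
    intro i hi
    split_ifs with h0
    · simp [h0]
    · have h1 : ω ^ m i ≠ 1 := by
        rw [Ne, hω.zpow_eq_one_iff_dvd]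
        intro hd
        have h2 := Nat.le_of_dvd (Int.natAbs_pos.2 h0) (Int.natCast_dvd.1 hd)
        have h3 : (m i).natAbs ≤ ∑ i ∈ s, (m i).natAbs :=
          Finset.single_le_sum (f := fun i => (m i).natAbs) (fun _ _ => Nat.zero_le _) hi
        omega
      have h4 : ∀ k : ℕ, (ω ^ k) ^ m i = (ω ^ m i) ^ k := fun k => by
        rw [← zpow_natCast, ← zpow_natCast, ← zpow_mul, ← zpow_mul, mul_comm]
      simp only [h4]
      have h5 := geom_sum_mul (ω ^ m i) N
      have h6 : (ω ^ m i) ^ N = 1 := by rw [← h4, hω.pow_eq_one, one_zpow]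
      rw [h6, sub_self, mul_eq_zero] at h5
      exact h5.resolve_right (sub_ne_zero.2 h1)
  have hsum : ∑ k ∈ Finset.range N, ∑ i ∈ s, ((W ^ k : Circle) : ℂ) ^ m i * c i =
      (N : ℝ) * ∑ i ∈ s, if m i = 0 then c i else 0 := by
    rw [Finset.sum_comm, Finset.mul_sum]
    refine Finset.sum_congr rfl fun i hi => ?_
    rw [← Finset.sum_mul]
    have : ∀ k, ((W ^ k : Circle) : ℂ) = ω ^ k := fun k => by rw [Circle.coe_pow]
    simp only [this]
    rw [hgeom i hi]
    split_ifs <;> simp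
  have h7 := Finset.sum_nonneg fun k (_ : k ∈ Finset.range N) => h (W ^ k)
  rw [hsum] at h7
  have hNpos : (0 : ℂ) < ((N : ℝ) : ℂ) := by
    rw [Complex.zero_lt_real]
    positivity
  have h8 := mul_nonneg (inv_nonneg.2 hNpos.le) h7
  rwa [← mul_assoc, inv_mul_cancel₀ hNpos.ne', one_mul] at h8

/-- A sesquilinear trigonometric polynomial that is nonnegative on the circle has nonnegative
Toeplitz forms. -/
theorem Circle.toeplitz_nonneg {E : Type*} [AddCommGroup E] [Module ℂ E] {ι κ : Type*}
    (t : Finset ι) (d : ι → ℤ) (q : ι → E →ₗ⋆[ℂ] E →ₗ[ℂ] ℂ)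
    (hq : ∀ (w : Circle) (v : E), 0 ≤ ∑ g ∈ t, (w : ℂ) ^ d g * q g v v)
    (s : Finset κ) (e : κ → ℤ) (x : κ → E) :
    0 ≤ ∑ g ∈ t, ∑ h ∈ s, ∑ k ∈ s, if e h = d g + e k then q g (x h) (x k) else 0 := by
  have key := Circle.constantCoeff_nonneg (t ×ˢ s ×ˢ s) (fun p => d p.1 - e p.2.1 + e p.2.2)
    (fun p => q p.1 (x p.2.1) (x p.2.2)) fun w => by
      -- With `v = ∑ w ^ e h • x h` the form becomes a scalar trigonometric polynomial in `w`, whose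
      -- constant coefficient is the Toeplitz form.
      refine (hq w (∑ h ∈ s, (w : ℂ) ^ e h • x h)).trans_eq ?_
      rw [Finset.sum_product]
      refine Finset.sum_congr rfl fun g _ => ?_
      rw [Finset.sum_product, map_sum (q g), LinearMap.sum_apply, Finset.mul_sum]
      refine Finset.sum_congr rfl fun h _ => ?_
      rw [map_sum, Finset.mul_sum]
      refine Finset.sum_congr rfl fun k _ => ?_
      have hw : (w : ℂ) ≠ 0 := Circle.coe_ne_zero w
      have hc : (starRingEnd ℂ) (w : ℂ) = (w : ℂ)⁻¹ := by
        rw [← Circle.coe_inv_eq_conj, Circle.coe_inv]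
      rw [map_smulₛₗ (q g), LinearMap.smul_apply, map_smul, smul_eq_mul, smul_eq_mul,
        map_zpow₀, hc, zpow_add₀ hw, zpow_sub₀ hw, inv_zpow]
      ring
  rw [Finset.sum_product] at key
  refine key.trans_eq (Finset.sum_congr rfl fun g _ => ?_)
  rw [Finset.sum_product]
  refine Finset.sum_congr rfl fun h _ => Finset.sum_congr rfl fun k _ => ?_
  congr 1
  simp only [eq_iff_iff]
  constructor <;> intro h <;> omega

/-! ### Positivity in reduced crossed products by a trivial action of `ℤ` -/

namespace AdmissibleCover

open OpSystem

variable {A : Type*} [CStarAlgebra A] {S : OpSystem A}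
  {C : Type*} [CStarAlgebra C] {H : Type*} [NormedAddCommGroup H] [InnerProductSpace ℂ H]
  [CompleteSpace H] (𝒞 : AdmissibleCover S (1 : Multiplicative ℤ →* S.Aut) C)
  (π : FaithfulRep C H) {𝔤 : Set (Multiplicative ℤ)} (h𝔤 : IsGeneratingSet 𝔤)

/-- The evaluation `∑ s_g λ_g ↦ ∑ w ^ g s_g` at a point `w` of the circle. -/
noncomputable def evalAt (w : Circle) : 𝒞.crossedProduct π h𝔤 →ₗ[ℂ] S :=
  (Finsupp.lsum ℂ fun g : 𝔤 => ((w : ℂ) ^ (g : Multiplicative ℤ).toAdd) •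
    (LinearMap.id : S →ₗ[ℂ] S)) ∘ₗ (𝒞.coeffEquiv π h𝔤).symm.toLinearMap

theorem evalAt_coeffEquiv_single (w : Circle) (g : 𝔤) (s : S) :
    𝒞.evalAt π h𝔤 w (𝒞.coeffEquiv π h𝔤 (Finsupp.single g s)) =
      (w : ℂ) ^ (g : Multiplicative ℤ).toAdd • s := by
  simp [evalAt]

/-- The coefficients of an element of the crossed product, as operators on `H`. -/
noncomputable def coeffOp (x : 𝒞.crossedProduct π h𝔤) (g : 𝔤) : H →L[ℂ] H :=
  π.toHom (𝒞.ρ ((𝒞.coeffEquiv π h𝔤).symm x g))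

theorem toHom_evalAt (w : Circle) (x : 𝒞.crossedProduct π h𝔤) (t : Finset 𝔤)
    (ht : ((𝒞.coeffEquiv π h𝔤).symm x).support ⊆ t) :
    π.toHom (𝒞.ρ (𝒞.evalAt π h𝔤 w x)) =
      ∑ g ∈ t, ((w : ℂ) ^ (g : Multiplicative ℤ).toAdd) • 𝒞.coeffOp π h𝔤 x g := by
  have : 𝒞.evalAt π h𝔤 w x = ∑ g ∈ t, ((w : ℂ) ^ (g : Multiplicative ℤ).toAdd) •
      (𝒞.coeffEquiv π h𝔤).symm x g := by
    rw [evalAt, LinearMap.comp_apply, Finsupp.lsum_apply]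
    exact Finsupp.sum_of_support_subset _ ht _ (by simp)
  rw [this]
  simp only [map_sum, map_smul, coeffOp]

theorem coe_eq_sum_elem (x : 𝒞.crossedProduct π h𝔤) (t : Finset 𝔤)
    (ht : ((𝒞.coeffEquiv π h𝔤).symm x).support ⊆ t) :
    (x : EllTwo (Multiplicative ℤ) H →L[ℂ] EllTwo (Multiplicative ℤ) H) =
      ∑ g ∈ t, 𝒞.elem π ((𝒞.coeffEquiv π h𝔤).symm x g) (g : Multiplicative ℤ) := by
  obtain ⟨f, rfl⟩ := (𝒞.coeffEquiv π h𝔤).surjective x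
  rw [LinearEquiv.symm_apply_apply] at *
  change 𝒞.sumMap π 𝔤 f = _
  rw [sumMap, Finsupp.lsum_apply, Finsupp.sum_of_support_subset _ ht _ (by simp)]
  rfl

theorem apply_single_apply (x : 𝒞.crossedProduct π h𝔤) (t : Finset 𝔤)
    (ht : ((𝒞.coeffEquiv π h𝔤).symm x).support ⊆ t) (k : Multiplicative ℤ) (v : H)
    (h : Multiplicative ℤ) :
    (x : EllTwo (Multiplicative ℤ) H →L[ℂ] EllTwo (Multiplicative ℤ) H) (lp.single 2 k v) h =
      ∑ g ∈ t, if h.toAdd = (g : Multiplicative ℤ).toAdd + k.toAdd then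
        𝒞.coeffOp π h𝔤 x g v else 0 := by
  rw [𝒞.coe_eq_sum_elem π h𝔤 x t ht, sum_apply, lp.coeFn_sum, Finset.sum_apply]
  refine Finset.sum_congr rfl fun g _ => ?_
  rw [elem_apply]
  have hiff : h.toAdd = (g : Multiplicative ℤ).toAdd + k.toAdd ↔ (g : Multiplicative ℤ)⁻¹ * h = k := by
    rw [inv_mul_eq_iff_eq_mul]
    exact Iff.rfl
  by_cases hk : (g : Multiplicative ℤ)⁻¹ * h = k
  · rw [if_pos (hiff.2 hk), hk, lp.single_apply_self]
    rfl
  · rw [if_neg (fun h' => hk (hiff.1 h')), lp.single_apply_ne _ _ _ hk, map_zero]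

/-- A finite set supporting the coefficients of all entries of a matrix. -/
noncomputable def supp {n : ℕ} (X : Matrix (Fin n) (Fin n) (𝒞.crossedProduct π h𝔤)) : Finset 𝔤 :=
  haveI := Classical.decEq 𝔤
  Finset.univ.biUnion fun i => Finset.univ.biUnion fun j =>
    ((𝒞.coeffEquiv π h𝔤).symm (X i j)).support

theorem support_subset_supp {n : ℕ} (X : Matrix (Fin n) (Fin n) (𝒞.crossedProduct π h𝔤))
    (i j : Fin n) : ((𝒞.coeffEquiv π h𝔤).symm (X i j)).support ⊆ 𝒞.supp π h𝔤 X := by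
  classical
  intro g hg
  simp only [supp, Finset.mem_biUnion, Finset.mem_univ, true_and]
  exact ⟨i, j, hg⟩

/-- Under the trivial action the operator is block Toeplitz: its `(h, k)` block depends only on `h -
k`. -/
theorem quadratic_eq {n : ℕ} (X : Matrix (Fin n) (Fin n) (𝒞.crossedProduct π h𝔤))
    (s : Finset (Multiplicative ℤ)) (x : Fin n → Multiplicative ℤ → H) :
    ∑ i, ∑ j, ⟪∑ h ∈ s, lp.single 2 h (x i h),
      (X i j : EllTwo (Multiplicative ℤ) H →L[ℂ] EllTwo (Multiplicative ℤ) H)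
        (∑ k ∈ s, lp.single 2 k (x j k))⟫_ℂ =
    ∑ g ∈ 𝒞.supp π h𝔤 X, ∑ h ∈ s, ∑ k ∈ s,
      if h.toAdd = (g : Multiplicative ℤ).toAdd + k.toAdd then
        ∑ i, ∑ j, ⟪x i h, 𝒞.coeffOp π h𝔤 (X i j) g (x j k)⟫_ℂ else 0 := by
  have h1 : ∀ i j, ⟪∑ h ∈ s, lp.single 2 h (x i h),
      (X i j : EllTwo (Multiplicative ℤ) H →L[ℂ] EllTwo (Multiplicative ℤ) H)
        (∑ k ∈ s, lp.single 2 k (x j k))⟫_ℂ = ∑ g ∈ 𝒞.supp π h𝔤 X, ∑ h ∈ s, ∑ k ∈ s,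
      if h.toAdd = (g : Multiplicative ℤ).toAdd + k.toAdd then
        ⟪x i h, 𝒞.coeffOp π h𝔤 (X i j) g (x j k)⟫_ℂ else 0 := by
    intro i j
    rw [sum_inner, Finset.sum_comm]
    refine Finset.sum_congr rfl fun h _ => ?_
    rw [map_sum, inner_sum, Finset.sum_comm]
    refine Finset.sum_congr rfl fun k _ => ?_
    rw [lp.inner_single_left, 𝒞.apply_single_apply π h𝔤 _ _ (𝒞.support_subset_supp π h𝔤 X i j),
      inner_sum]
    refine Finset.sum_congr rfl fun g _ => ?_
    rw [apply_ite (fun v => ⟪x i h, v⟫_ℂ), inner_zero_right]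
  simp only [h1]
  simp only [Finset.sum_comm (s := Finset.univ) (t := 𝒞.supp π h𝔤 X)]
  refine Finset.sum_congr rfl fun g _ => ?_
  simp only [Finset.sum_comm (s := Finset.univ) (t := s)]
  refine Finset.sum_congr rfl fun h _ => Finset.sum_congr rfl fun k _ => ?_
  split_ifs <;> simp

theorem isPos_evalAt_iff {n : ℕ} (X : Matrix (Fin n) (Fin n) (𝒞.crossedProduct π h𝔤))
    (w : Circle) : S.IsPos (X.map (𝒞.evalAt π h𝔤 w)) ↔ ∀ v : Fin n → H,
      0 ≤ ∑ g ∈ 𝒞.supp π h𝔤 X, (w : ℂ) ^ (g : Multiplicative ℤ).toAdd *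
        ∑ i, ∑ j, ⟪v i, 𝒞.coeffOp π h𝔤 (X i j) g (v j)⟫_ℂ := by
  rw [← 𝒞.pos_iff, ← IsPosMatrix.map_iff π.toHom π.injective, IsPosMatrix.iff_inner_nonneg]
  refine forall_congr' fun v => ?_
  have : ∑ i, ∑ j, ⟪v i, (((X.map (𝒞.evalAt π h𝔤 w)).map 𝒞.ρ).map π.toHom) i j (v j)⟫_ℂ =
      ∑ g ∈ 𝒞.supp π h𝔤 X, (w : ℂ) ^ (g : Multiplicative ℤ).toAdd *
        ∑ i, ∑ j, ⟪v i, 𝒞.coeffOp π h𝔤 (X i j) g (v j)⟫_ℂ := by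
    simp only [Matrix.map_apply, Finset.mul_sum]
    simp only [Finset.sum_comm (t := (Finset.univ : Finset (Fin n))) (s := 𝒞.supp π h𝔤 X)]
    refine Finset.sum_congr rfl fun i _ => Finset.sum_congr rfl fun j _ => ?_
    rw [𝒞.toHom_evalAt π h𝔤 w _ _ (𝒞.support_subset_supp π h𝔤 X i j), sum_apply, inner_sum]
    refine Finset.sum_congr rfl fun g _ => ?_
    rw [smul_apply, inner_smul_right]
  rw [this]

/-- On finitely supported vectors the quadratic form is a Toeplitz form of a pointwise nonnegative
polynomial; such vectors are dense. -/
theorem isPos_of_forall_evalAt {n : ℕ} (X : Matrix (Fin n) (Fin n) (𝒞.crossedProduct π h𝔤))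
    (hX : ∀ w, S.IsPos (X.map (𝒞.evalAt π h𝔤 w))) : (𝒞.crossedProduct π h𝔤).IsPos X := by
  rw [OpSystem.IsPos, IsPosMatrix.iff_inner_nonneg]
  intro ξ
  have hlim : Filter.Tendsto (fun s : Finset (Multiplicative ℤ) =>
      ∑ i, ∑ j, ⟪∑ h ∈ s, lp.single 2 h (ξ i h),
      (X i j : EllTwo (Multiplicative ℤ) H →L[ℂ] EllTwo (Multiplicative ℤ) H)
        (∑ k ∈ s, lp.single 2 k (ξ j k))⟫_ℂ) Filter.atTop
      (nhds (∑ i, ∑ j, ⟪ξ i, (X i j : EllTwo (Multiplicative ℤ) H →L[ℂ]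
        EllTwo (Multiplicative ℤ) H) (ξ j)⟫_ℂ)) := by
    have hs : ∀ i, Filter.Tendsto (fun s : Finset (Multiplicative ℤ) =>
        ∑ h ∈ s, lp.single 2 h (ξ i h)) Filter.atTop (nhds (ξ i)) := fun i =>
      lp.hasSum_single (by norm_num) (ξ i)
    refine tendsto_finsetSum _ fun i _ => tendsto_finsetSum _ fun j _ => ?_
    exact (hs i).inner (((X i j : EllTwo (Multiplicative ℤ) H →L[ℂ]
        EllTwo (Multiplicative ℤ) H).continuous.tendsto _).comp (hs j))
  refine ge_of_tendsto' hlim fun s => ?_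
  rw [𝒞.quadratic_eq π h𝔤 X s fun i h => ξ i h]
  let q : 𝔤 → (Fin n → H) →ₗ⋆[ℂ] (Fin n → H) →ₗ[ℂ] ℂ := fun g =>
    LinearMap.mk₂'ₛₗ (starRingEnd ℂ) (RingHom.id ℂ)
      (fun v v' => ∑ i, ∑ j, ⟪v i, 𝒞.coeffOp π h𝔤 (X i j) g (v' j)⟫_ℂ)
      (by intro a b c; simp [Finset.sum_add_distrib])
      (by intro a b c; simp [Finset.mul_sum, mul_comm])
      (by intro a b c; simp [Finset.sum_add_distrib])
      (by intro a b c; simp [Finset.mul_sum])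
  exact Circle.toeplitz_nonneg (𝒞.supp π h𝔤 X) (fun g => (g : Multiplicative ℤ).toAdd) q
    (fun w v => (𝒞.isPos_evalAt_iff π h𝔤 X w).1 (hX w) v) s (fun h => h.toAdd)
    (fun h i => ξ i h)

/-- Intervals in `ℤ` are Følner: for `N ≥ |d|` exactly `N - |d|` pairs in `[0, N)²` have difference
`d`. -/
theorem tendsto_card_shift (d : ℤ) :
    Filter.Tendsto (fun N : ℕ => ((∑ h ∈ Finset.range N, ∑ k ∈ Finset.range N,
      if (h : ℤ) = d + k then (1 : ℝ) else 0) / N)) Filter.atTop (nhds 1) := by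
  have hle : ∀ N : ℕ, (∑ h ∈ Finset.range N, ∑ k ∈ Finset.range N,
      if (h : ℤ) = d + k then (1 : ℝ) else 0) ≤ N := by
    intro N
    calc _ ≤ ∑ h ∈ Finset.range N, (1 : ℝ) := by
          refine Finset.sum_le_sum fun h _ => ?_
          rw [Finset.sum_ite, Finset.sum_const_zero, add_zero, Finset.sum_const, nsmul_eq_mul,
            mul_one]
          have : (Finset.filter (fun k : ℕ => (h : ℤ) = d + k) (Finset.range N)).card ≤ 1 :=
            Finset.card_le_one.2 fun a ha b hb => by
              simp only [Finset.mem_filter] at ha hb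
              omega
          exact_mod_cast this
      _ = N := by simp
  have hge : ∀ N : ℕ, (N : ℝ) - |(d : ℝ)| ≤ ∑ h ∈ Finset.range N, ∑ k ∈ Finset.range N,
      if (h : ℤ) = d + k then (1 : ℝ) else 0 := by
    intro N
    have h1 : ∀ h ∈ Finset.range N, (if d ≤ h ∧ (h : ℤ) < d + N then (1 : ℝ) else 0) ≤
        ∑ k ∈ Finset.range N, if (h : ℤ) = d + k then (1 : ℝ) else 0 := by
      intro h _
      split_ifs with hc
      · have hk : (h - d).toNat ∈ Finset.range N := by rw [Finset.mem_range]; omega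
        refine le_trans ?_ (Finset.single_le_sum
          (f := fun k : ℕ => if (h : ℤ) = d + k then (1 : ℝ) else 0)
          (fun _ _ => by positivity) hk)
        rw [if_pos (by omega)]
      · exact Finset.sum_nonneg fun _ _ => by positivity
    refine le_trans ?_ (Finset.sum_le_sum h1)
    rw [Finset.sum_ite, Finset.sum_const_zero, add_zero, Finset.sum_const, nsmul_eq_mul, mul_one]
    have h2 : Finset.Ico d.toNat (N - (-d).toNat) ⊆
        Finset.filter (fun h : ℕ => d ≤ h ∧ (h : ℤ) < d + N) (Finset.range N) := by
      intro h hh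
      simp only [Finset.mem_Ico, Finset.mem_filter, Finset.mem_range] at *
      omega
    have h3 := Finset.card_le_card h2
    rw [Nat.card_Ico] at h3
    have h4 : (N : ℤ) - |d| ≤
        (Finset.filter (fun h : ℕ => d ≤ h ∧ (h : ℤ) < d + N) (Finset.range N)).card := by
      rcases abs_cases d with ⟨h5, _⟩ | ⟨h5, _⟩ <;> rw [h5] <;> omega
    exact_mod_cast h4
  have hlim : Filter.Tendsto (fun N : ℕ => 1 - |(d : ℝ)| / N) Filter.atTop (nhds 1) := by
    simpa using (tendsto_const_div_atTop_nhds_zero_nat |(d : ℝ)|).const_sub 1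
  refine tendsto_of_tendsto_of_tendsto_of_le_of_le' hlim tendsto_const_nhds ?_ ?_
  · filter_upwards [Filter.eventually_gt_atTop 0] with N hN
    have hN' : (0 : ℝ) < N := by exact_mod_cast hN
    rw [le_div_iff₀ hN', sub_mul, div_mul_cancel₀ _ hN'.ne', one_mul]
    exact hge N
  · filter_upwards [Filter.eventually_gt_atTop 0] with N hN
    have hN' : (0 : ℝ) < N := by exact_mod_cast hN
    rw [div_le_one hN']
    exact hle N

/-- The functions `h ↦ w ^ (-h)` on long intervals are approximate eigenvectors of the translations,
so the normalised quadratic form on them converges to the form of the value at `w`. -/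
theorem isPos_evalAt {n : ℕ} {X : Matrix (Fin n) (Fin n) (𝒞.crossedProduct π h𝔤)}
    (hX : (𝒞.crossedProduct π h𝔤).IsPos X) (w : Circle) :
    S.IsPos (X.map (𝒞.evalAt π h𝔤 w)) := by
  rw [isPos_evalAt_iff]
  intro v
  rw [OpSystem.IsPos, IsPosMatrix.iff_inner_nonneg] at hX
  obtain ⟨Q, hQ⟩ : ∃ Q : 𝔤 → ℂ, ∀ g, Q g =
    ∑ i, ∑ j, ⟪v i, 𝒞.coeffOp π h𝔤 (X i j) g (v j)⟫_ℂ := ⟨_, fun _ => rfl⟩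
  simp only [← hQ]
  have hlim : Filter.Tendsto (fun N : ℕ => ∑ g ∈ 𝒞.supp π h𝔤 X,
      (w : ℂ) ^ (g : Multiplicative ℤ).toAdd * Q g *
      (((∑ h ∈ Finset.range N, ∑ k ∈ Finset.range N,
        if (h : ℤ) = (g : Multiplicative ℤ).toAdd + k then (1 : ℝ) else 0) / N : ℝ) : ℂ))
      Filter.atTop (nhds (∑ g ∈ 𝒞.supp π h𝔤 X, (w : ℂ) ^ (g : Multiplicative ℤ).toAdd * Q g)) := by
    refine tendsto_finsetSum _ fun g _ => ?_
    have h1 := (Complex.continuous_ofReal.tendsto _).comp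
      (tendsto_card_shift (g : Multiplicative ℤ).toAdd)
    simpa using h1.const_mul ((w : ℂ) ^ (g : Multiplicative ℤ).toAdd * Q g)
  refine ge_of_tendsto' hlim fun N => ?_
  obtain ⟨e, he⟩ : ∃ e : ℕ ↪ Multiplicative ℤ, ∀ h, (e h).toAdd = h :=
    ⟨⟨fun h => Multiplicative.ofAdd (h : ℤ), fun a b hab => by simpa using hab⟩, fun _ => rfl⟩
  -- A pair with `h = g + k` contributes `w ^ h * w ^ (-k) = w ^ g` times the form of the
  -- coefficient at `g`.
  have h2 := hX fun j => ∑ h ∈ (Finset.range N).map e,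
    lp.single 2 h (((w : ℂ) ^ h.toAdd)⁻¹ • v j)
  simp only [Matrix.map_apply] at h2
  rw [𝒞.quadratic_eq π h𝔤 X _ fun j h => ((w : ℂ) ^ h.toAdd)⁻¹ • v j] at h2
  have h3 : ∑ g ∈ 𝒞.supp π h𝔤 X,
      (w : ℂ) ^ (g : Multiplicative ℤ).toAdd * Q g *
      (((∑ h ∈ Finset.range N, ∑ k ∈ Finset.range N,
        if (h : ℤ) = (g : Multiplicative ℤ).toAdd + k then (1 : ℝ) else 0) / N : ℝ) : ℂ) =
      ((1 / N : ℝ) : ℂ) * (∑ g ∈ 𝒞.supp π h𝔤 X, ∑ h ∈ Finset.range N, ∑ k ∈ Finset.range N,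
        if (h : ℤ) = (g : Multiplicative ℤ).toAdd + k then
          (w : ℂ) ^ (g : Multiplicative ℤ).toAdd * Q g else 0) := by
    rw [Finset.mul_sum]
    refine Finset.sum_congr rfl fun g _ => ?_
    push_cast
    rw [div_eq_mul_one_div, mul_comm _ (1 / (N : ℂ)), mul_left_comm, Finset.mul_sum]
    congr 1
    refine Finset.sum_congr rfl fun h _ => ?_
    rw [Finset.mul_sum]
    refine Finset.sum_congr rfl fun k _ => ?_
    split_ifs <;> simp
  rw [h3]
  refine mul_nonneg (by rw [Complex.zero_le_real]; positivity) (h2.trans_eq ?_)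
  simp only [Finset.sum_map, he]
  refine Finset.sum_congr rfl fun g _ => Finset.sum_congr rfl fun h _ =>
    Finset.sum_congr rfl fun k _ => ?_
  split_ifs with hg
  · rw [hQ, Finset.mul_sum]
    refine Finset.sum_congr rfl fun i _ => ?_
    rw [Finset.mul_sum]
    refine Finset.sum_congr rfl fun j _ => ?_
    have hw : (w : ℂ) ≠ 0 := Circle.coe_ne_zero w
    have hc : (starRingEnd ℂ) (w : ℂ) = (w : ℂ)⁻¹ := by
      rw [← Circle.coe_inv_eq_conj, Circle.coe_inv]
    rw [map_smul, inner_smul_left, inner_smul_right, map_inv₀, map_zpow₀, hc, inv_zpow, inv_inv, hg,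
      zpow_add₀ hw, ← mul_assoc, mul_assoc ((w : ℂ) ^ _), mul_inv_cancel₀ (zpow_ne_zero _ hw),
      mul_one]
  · rfl

/-- An element of `M_n(S ⋊ 𝔤)` is positive if and only if it is pointwise positive. -/
theorem isPos_iff_forall_evalAt {n : ℕ} {X : Matrix (Fin n) (Fin n) (𝒞.crossedProduct π h𝔤)} :
    (𝒞.crossedProduct π h𝔤).IsPos X ↔ ∀ w, S.IsPos (X.map (𝒞.evalAt π h𝔤 w)) :=
  ⟨fun hX w => 𝒞.isPos_evalAt π h𝔤 hX w, 𝒞.isPos_of_forall_evalAt π h𝔤 X⟩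

/-! ### Evaluation and induced maps. -/

theorem evalAt_inducedMap {B : Type*} [CStarAlgebra B] {T : OpSystem B}
    {D : Type*} [CStarAlgebra D] {K : Type*} [NormedAddCommGroup K] [InnerProductSpace ℂ K]
    [CompleteSpace K] (𝒟 : AdmissibleCover T (1 : Multiplicative ℤ →* T.Aut) D)
    (τ : FaithfulRep D K) (φ : S →ₗ[ℂ] T) (w : Circle) (x : 𝒞.crossedProduct π h𝔤) :
    𝒟.evalAt τ h𝔤 w (𝒞.inducedMap π 𝒟 τ h𝔤 φ x) = φ (𝒞.evalAt π h𝔤 w x) := by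
  obtain ⟨f, rfl⟩ := (𝒞.coeffEquiv π h𝔤).surjective x
  induction f using Finsupp.induction_linear with
  | zero => simp
  | add f g hf hg => simp only [map_add, hf, hg]
  | single g s =>
    rw [evalAt_coeffEquiv_single, inducedMap]
    simp only [LinearMap.comp_apply, LinearEquiv.coe_coe, LinearEquiv.symm_apply_apply,
      Finsupp.mapRange.linearMap_apply, Finsupp.mapRange_single]
    rw [evalAt_coeffEquiv_single, map_smul]

theorem evalAt_eq_of_inducedMap_eq {B : Type*} [CStarAlgebra B] {T : OpSystem B}
    {D : Type*} [CStarAlgebra D] {K : Type*} [NormedAddCommGroup K] [InnerProductSpace ℂ K]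
    [CompleteSpace K] (𝒟 : AdmissibleCover T (1 : Multiplicative ℤ →* T.Aut) D)
    (τ : FaithfulRep D K) (φ : S →ₗ[ℂ] T) (w : Circle) {x y : 𝒞.crossedProduct π h𝔤}
    {r : 𝒟.crossedProduct τ h𝔤}
    (h : 𝒞.inducedMap π 𝒟 τ h𝔤 φ y = 𝒞.inducedMap π 𝒟 τ h𝔤 φ x + r) :
    φ (𝒞.evalAt π h𝔤 w y) = φ (𝒞.evalAt π h𝔤 w x) + 𝒟.evalAt τ h𝔤 w r := by
  rw [← 𝒞.evalAt_inducedMap π h𝔤 𝒟 τ φ w y, ← 𝒞.evalAt_inducedMap π h𝔤 𝒟 τ φ w x, h, map_add]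

theorem unit_eq_coeffEquiv :
    (𝒞.crossedProduct π h𝔤).unit = 𝒞.coeffEquiv π h𝔤 (Finsupp.single ⟨1, h𝔤.one_mem⟩ S.unit) := by
  apply Subtype.ext
  rw [coeffEquiv_single]
  ext ξ h
  rw [elem_apply, ← 𝒞.act_apply, 𝒞.map_unit]
  simp [OpSystem.unit]

theorem evalAt_unit (w : Circle) :
    𝒞.evalAt π h𝔤 w (𝒞.crossedProduct π h𝔤).unit = S.unit := by
  rw [unit_eq_coeffEquiv, evalAt_coeffEquiv_single]
  simp

theorem isUCP_inducedMap {B : Type*} [CStarAlgebra B] {T : OpSystem B}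
    {D : Type*} [CStarAlgebra D] {K : Type*} [NormedAddCommGroup K] [InnerProductSpace ℂ K]
    [CompleteSpace K] (𝒟 : AdmissibleCover T (1 : Multiplicative ℤ →* T.Aut) D)
    (τ : FaithfulRep D K) {φ : S →ₗ[ℂ] T} (hφ : IsUCP φ) :
    IsUCP (𝒞.inducedMap π 𝒟 τ h𝔤 φ) where
  map_unit := by
    rw [unit_eq_coeffEquiv, unit_eq_coeffEquiv, inducedMap]
    simp [hφ.map_unit]
  map_pos n X hX := by
    rw [isPos_iff_forall_evalAt] at hX ⊢
    intro w
    have := hφ.map_pos n _ (hX w)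
    rw [Matrix.map_map] at this ⊢
    convert this using 2
    funext x
    exact 𝒞.evalAt_inducedMap π h𝔤 𝒟 τ φ w x

end AdmissibleCover

/-! ### Matrix-valued trigonometric polynomials of degree one -/

namespace Matrix

variable {n : ℕ}

/-- The sesquilinear form of a square matrix. -/
noncomputable def sesq (M : Matrix (Fin n) (Fin n) ℂ) :
    (Fin n → ℂ) →ₗ⋆[ℂ] (Fin n → ℂ) →ₗ[ℂ] ℂ :=
  LinearMap.mk₂'ₛₗ (starRingEnd ℂ) (RingHom.id ℂ) (fun x y => star x ⬝ᵥ M *ᵥ y)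
    (by intro a b c; simp [add_dotProduct])
    (by intro a b c; simp [smul_dotProduct])
    (by intro a b c; simp [mulVec_add, dotProduct_add])
    (by intro a b c; simp [mulVec_smul, dotProduct_smul])

theorem sesq_apply (M : Matrix (Fin n) (Fin n) ℂ) (x y : Fin n → ℂ) :
    sesq M x y = star x ⬝ᵥ M *ᵥ y := rfl

theorem sesq_eq_sum (M : Matrix (Fin n) (Fin n) ℂ) (x y : Fin n → ℂ) :
    sesq M x y = ∑ i, ∑ j, star (x i) * M i j * y j := by
  simp only [sesq_apply, dotProduct, mulVec, Pi.star_apply, Finset.mul_sum, mul_assoc]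

theorem sesq_add (M N : Matrix (Fin n) (Fin n) ℂ) (x y : Fin n → ℂ) :
    sesq (M + N) x y = sesq M x y + sesq N x y := by
  simp [sesq_apply, add_mulVec, dotProduct_add]

theorem sesq_sub (M N : Matrix (Fin n) (Fin n) ℂ) (x y : Fin n → ℂ) :
    sesq (M - N) x y = sesq M x y - sesq N x y := by
  simp [sesq_apply, sub_mulVec, dotProduct_sub]

theorem sesq_smul (c : ℂ) (M : Matrix (Fin n) (Fin n) ℂ) (x y : Fin n → ℂ) :
    sesq (c • M) x y = c * sesq M x y := by
  simp [sesq_apply, smul_mulVec, dotProduct_smul]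

theorem sesq_sum {ι : Type*} (s : Finset ι) (M : ι → Matrix (Fin n) (Fin n) ℂ)
    (x y : Fin n → ℂ) : sesq (∑ i ∈ s, M i) x y = ∑ i ∈ s, sesq (M i) x y := by
  classical
  induction s using Finset.induction_on with
  | empty => simp [sesq_apply]
  | insert i s hi ih => rw [Finset.sum_insert hi, Finset.sum_insert hi, sesq_add, ih]

theorem PosSemidef.sesq_nonneg {M : Matrix (Fin n) (Fin n) ℂ} (hM : M.PosSemidef)
    (x : Fin n → ℂ) : 0 ≤ sesq M x x := hM.dotProduct_mulVec_nonneg x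

open scoped MatrixOrder Matrix.Norms.L2Operator in
theorem IsHermitian.exists_smul_one_sub_posSemidef {M : Matrix (Fin n) (Fin n) ℂ}
    (hM : M.IsHermitian) : ∃ c : ℝ, ((c : ℂ) • (1 : Matrix (Fin n) (Fin n) ℂ) - M).PosSemidef := by
  refine ⟨‖M‖, ?_⟩
  have h := IsSelfAdjoint.le_algebraMap_norm_self (a := M) hM
  rw [Matrix.le_iff] at h
  have h1 : ((‖M‖ : ℝ) : ℂ) • (1 : Matrix (Fin n) (Fin n) ℂ) = algebraMap ℝ _ ‖M‖ := by
    rw [Algebra.algebraMap_eq_smul_one]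
    ext i j
    simp
  rwa [h1]

/-- The Toeplitz forms of `A₀ + w A₁ + w⁻¹ A₋₁` are nonnegative. -/
theorem toeplitz_nonneg {A₀ A₁ B₁ : Matrix (Fin n) (Fin n) ℂ}
    (h : ∀ w : Circle, (A₀ + (w : ℂ) • A₁ + (w : ℂ)⁻¹ • B₁).PosSemidef) (N : ℕ)
    (x : ℕ → Fin n → ℂ) :
    0 ≤ ∑ k ∈ Finset.range (N + 1), sesq A₀ (x k) (x k) + ∑ k ∈ Finset.range N,
      (sesq A₁ (x (k + 1)) (x k) + sesq B₁ (x k) (x (k + 1))) := by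
  have key := Circle.toeplitz_nonneg (Finset.univ : Finset (Fin 3)) ![0, 1, -1]
    ![sesq A₀, sesq A₁, sesq B₁] (fun w v => by
      have h1 := (h w).sesq_nonneg v
      rw [sesq_add, sesq_add, sesq_smul, sesq_smul] at h1
      simpa [Fin.sum_univ_three] using h1) (Finset.range (N + 1)) (fun k => (k : ℤ)) x
  rw [Fin.sum_univ_three] at key
  have key' : 0 ≤ (∑ h ∈ Finset.range (N + 1), ∑ k ∈ Finset.range (N + 1),
        if (h : ℤ) = 0 + k then sesq A₀ (x h) (x k) else 0) +
      (∑ h ∈ Finset.range (N + 1), ∑ k ∈ Finset.range (N + 1),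
        if (h : ℤ) = 1 + k then sesq A₁ (x h) (x k) else 0) +
      ∑ h ∈ Finset.range (N + 1), ∑ k ∈ Finset.range (N + 1),
        if (h : ℤ) = -1 + k then sesq B₁ (x h) (x k) else 0 := key
  refine key'.trans_eq ?_
  simp only [zero_add, Nat.cast_inj, Finset.sum_ite_eq]
  rw [Finset.sum_add_distrib, ← add_assoc]
  congr 1
  · congr 1
    · exact Finset.sum_congr rfl fun k hk => if_pos hk
    · rw [Finset.sum_comm, Finset.sum_range_succ]
      have h0 : ∑ h ∈ Finset.range (N + 1),
          (if (h : ℤ) = 1 + (N : ℤ) then sesq A₁ (x h) (x N) else 0) = 0 :=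
        Finset.sum_eq_zero fun h hh => if_neg (by rw [Finset.mem_range] at hh; omega)
      rw [h0, add_zero]
      refine Finset.sum_congr rfl fun k hk => ?_
      rw [Finset.mem_range] at hk
      rw [Finset.sum_eq_single (k + 1)]
      · rw [if_pos (by push_cast; ring)]
      · intro h _ hne
        exact if_neg (by omega)
      · intro hh
        rw [Finset.mem_range] at hh
        omega
  · rw [Finset.sum_range_succ]
    have h0 : ∑ k ∈ Finset.range (N + 1),
        (if (N : ℤ) = -1 + (k : ℤ) then sesq B₁ (x N) (x k) else 0) = 0 :=
      Finset.sum_eq_zero fun h hh => if_neg (by rw [Finset.mem_range] at hh; omega)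
    rw [h0, add_zero]
    refine Finset.sum_congr rfl fun k hk => ?_
    rw [Finset.mem_range] at hk
    rw [Finset.sum_eq_single (k + 1)]
    · rw [if_pos (by push_cast; ring)]
    · intro h _ hne
      exact if_neg (by omega)
    · intro hh
      rw [Finset.mem_range] at hh
      omega

/-- The iterated Schur complements of the block Toeplitz matrices with diagonal blocks `A₀` and
off-diagonal blocks `A₁`, `A₁ᴴ`. -/
noncomputable def schurSeq (A₀ A₁ : Matrix (Fin n) (Fin n) ℂ) : ℕ → Matrix (Fin n) (Fin n) ℂ
  | 0 => A₀
  | k + 1 => A₀ - A₁ * (schurSeq A₀ A₁ k)⁻¹ * A₁ᴴ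

/-- Completing squares successively in `x 0, ..., x (N - 1)` with `x N = v` fixed leaves the Schur
complement evaluated at `v`. The assumed lower bound at the vector so obtained gives definiteness,
which in turn makes the next complement meaningful; hence both claims go through one induction. -/
theorem schurSeq_posDef {A₀ A₁ : Matrix (Fin n) (Fin n) ℂ} {δ : ℝ} (hδ : 0 < δ)
    (hA₀ : A₀.IsHermitian)
    (h : ∀ (N : ℕ) (x : ℕ → Fin n → ℂ), (δ : ℂ) * (star (x N) ⬝ᵥ x N) ≤
      ∑ k ∈ Finset.range (N + 1), sesq A₀ (x k) (x k) + ∑ k ∈ Finset.range N,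
        (sesq A₁ (x (k + 1)) (x k) + sesq A₁ᴴ (x k) (x (k + 1)))) (N : ℕ) :
    (schurSeq A₀ A₁ N).PosDef ∧ ∀ v, ∃ x : ℕ → Fin n → ℂ, x N = v ∧
      ∑ k ∈ Finset.range (N + 1), sesq A₀ (x k) (x k) + ∑ k ∈ Finset.range N,
        (sesq A₁ (x (k + 1)) (x k) + sesq A₁ᴴ (x k) (x (k + 1))) =
      sesq (schurSeq A₀ A₁ N) v v := by
  have posDef_of : ∀ N : ℕ, (schurSeq A₀ A₁ N).IsHermitian → (∀ v, ∃ x : ℕ → Fin n → ℂ, x N = v ∧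
      ∑ k ∈ Finset.range (N + 1), sesq A₀ (x k) (x k) + ∑ k ∈ Finset.range N,
        (sesq A₁ (x (k + 1)) (x k) + sesq A₁ᴴ (x k) (x (k + 1))) =
      sesq (schurSeq A₀ A₁ N) v v) → (schurSeq A₀ A₁ N).PosDef := by
    intro N hH hx
    refine PosDef.of_dotProduct_mulVec_pos hH fun v hv => ?_
    obtain ⟨x, hxN, hxs⟩ := hx v
    have h1 := h N x
    rw [hxs, hxN] at h1
    refine lt_of_lt_of_le (mul_pos ?_ ?_) h1
    · rwa [Complex.zero_lt_real]
    · exact dotProduct_star_self_pos_iff.2 hv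
  induction N with
  | zero =>
    have hx : ∀ v, ∃ x : ℕ → Fin n → ℂ, x 0 = v ∧
      ∑ k ∈ Finset.range (0 + 1), sesq A₀ (x k) (x k) + ∑ k ∈ Finset.range 0,
        (sesq A₁ (x (k + 1)) (x k) + sesq A₁ᴴ (x k) (x (k + 1))) =
      sesq (schurSeq A₀ A₁ 0) v v := fun v => ⟨fun _ => v, rfl, by simp [schurSeq]⟩
    exact ⟨posDef_of 0 hA₀ hx, hx⟩
  | succ N ih =>
    obtain ⟨hpd, hx⟩ := ih
    have hH : (schurSeq A₀ A₁ (N + 1)).IsHermitian := by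
      refine hA₀.sub ?_
      rw [IsHermitian, conjTranspose_mul, conjTranspose_mul, conjTranspose_conjTranspose,
        hpd.inv.isHermitian.eq, mul_assoc]
    have hx' : ∀ v, ∃ x : ℕ → Fin n → ℂ, x (N + 1) = v ∧
      ∑ k ∈ Finset.range (N + 1 + 1), sesq A₀ (x k) (x k) + ∑ k ∈ Finset.range (N + 1),
        (sesq A₁ (x (k + 1)) (x k) + sesq A₁ᴴ (x k) (x (k + 1))) =
      sesq (schurSeq A₀ A₁ (N + 1)) v v := by
      intro v
      -- The critical point in `u` of `⟨u, S_N u⟩ + ⟨v, A₁ u⟩ + ⟨u, A₁ᴴ v⟩`, where `S_N` is the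
      -- current Schur complement.
      obtain ⟨u, hu⟩ : ∃ u, u = -((schurSeq A₀ A₁ N)⁻¹ *ᵥ (A₁ᴴ *ᵥ v)) := ⟨_, rfl⟩
      obtain ⟨x, hxN, hxs⟩ := hx u
      refine ⟨Function.update x (N + 1) v, by simp, ?_⟩
      have hne : ∀ k ≤ N, Function.update x (N + 1) v k = x k := fun k hk =>
        Function.update_of_ne (by omega) _ _
      have h1 : ∑ k ∈ Finset.range (N + 1), sesq A₀ (Function.update x (N + 1) v k)
          (Function.update x (N + 1) v k) = ∑ k ∈ Finset.range (N + 1), sesq A₀ (x k) (x k) :=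
        Finset.sum_congr rfl fun k hk => by
          rw [Finset.mem_range] at hk
          rw [hne k (by omega)]
      have h2 : ∑ k ∈ Finset.range N, (sesq A₁ (Function.update x (N + 1) v (k + 1))
            (Function.update x (N + 1) v k) + sesq A₁ᴴ (Function.update x (N + 1) v k)
            (Function.update x (N + 1) v (k + 1))) = ∑ k ∈ Finset.range N,
          (sesq A₁ (x (k + 1)) (x k) + sesq A₁ᴴ (x k) (x (k + 1))) :=
        Finset.sum_congr rfl fun k hk => by
          rw [Finset.mem_range] at hk
          rw [hne k (by omega), hne (k + 1) (by omega)]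
      rw [Finset.sum_range_succ _ (N + 1), Finset.sum_range_succ (fun k =>
        sesq A₁ (Function.update x (N + 1) v (k + 1)) (Function.update x (N + 1) v k) +
        sesq A₁ᴴ (Function.update x (N + 1) v k) (Function.update x (N + 1) v (k + 1))) N, h1, h2, hne N le_rfl, hxN,
        Function.update_self]
      have hPu : schurSeq A₀ A₁ N *ᵥ u = -(A₁ᴴ *ᵥ v) := by
        rw [hu, mulVec_neg, mulVec_mulVec, mul_nonsing_inv _ ((isUnit_iff_isUnit_det _).1 hpd.isUnit),
          one_mulVec]
      have h3 : sesq (schurSeq A₀ A₁ N) u u = -sesq A₁ᴴ u v := by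
        rw [sesq_apply, hPu, dotProduct_neg, sesq_apply]
      have h4 : sesq A₁ v u = -sesq (A₁ * (schurSeq A₀ A₁ N)⁻¹ * A₁ᴴ) v v := by
        rw [sesq_apply, sesq_apply, hu, mulVec_neg, dotProduct_neg, mulVec_mulVec, mulVec_mulVec,
          mul_assoc]
      rw [schurSeq, sesq_sub]
      linear_combination hxs + h3 + h4
    exact ⟨posDef_of (N + 1) hH hx', hx'⟩

/-- The block matrix has positive definite corner `P` with zero Schur complement. -/
theorem schur_block_nonneg {P A₁ : Matrix (Fin n) (Fin n) ℂ} (hP : P.PosDef) (x y : Fin n → ℂ) :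
    0 ≤ sesq (A₁ * P⁻¹ * A₁ᴴ) x x + sesq A₁ x y + sesq A₁ᴴ y x + sesq P y y := by
  have := hP.isUnit.invertible
  have h := (hP.fromBlocks₁₁ A₁ᴴ (A₁ * P⁻¹ * A₁ᴴ)).2 (by
    rw [conjTranspose_conjTranspose, sub_self]
    exact PosSemidef.zero)
  have h1 := h.dotProduct_mulVec_nonneg (Sum.elim y x)
  refine h1.trans_eq ?_
  rw [fromBlocks_mulVec]
  simp only [sesq_apply, dotProduct, Fintype.sum_sum_type, Sum.elim_inl, Sum.elim_inr,
    Pi.star_apply, conjTranspose_conjTranspose, Pi.add_apply, mul_add, Finset.sum_add_distrib,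
    Function.comp_def]
  ring

/-- A degree one operator Fejér–Riesz theorem, up to an arbitrarily small perturbation. -/
theorem exists_block_decomposition {A₀ A₁ B₁ : Matrix (Fin n) (Fin n) ℂ}
    (h : ∀ w : Circle, (A₀ + (w : ℂ) • A₁ + (w : ℂ)⁻¹ • B₁).PosSemidef) {ε : ℝ} (hε : 0 < ε) :
    ∃ P Q : Matrix (Fin n) (Fin n) ℂ, P + Q = A₀ + (ε : ℂ) • (1 : Matrix (Fin n) (Fin n) ℂ) ∧
      ∀ x y, 0 ≤ sesq P x x + sesq A₁ x y + sesq B₁ y x + sesq Q y y := by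
  -- Self-adjointness at `w = 1, -1, i` already determines the relations between the three
  -- coefficients.
  have hherm : A₀.IsHermitian ∧ B₁ = A₁ᴴ := by
    have h1 := (h 1).isHermitian.eq
    have h2 := (h (-1)).isHermitian.eq
    have h3 := (h ⟨Complex.I, by simp [Submonoid.unitSphere]⟩).isHermitian.eq
    simp only [conjTranspose_add, conjTranspose_smul, Circle.coe_one, Circle.coe_neg, inv_neg,
      inv_one, conjTranspose_neg, neg_smul, one_smul, Complex.inv_I, Complex.star_def,
      Complex.conj_I, neg_neg] at h1 h2 h3
    have h4 : ∀ i j, A₀ᴴ i j = A₀ i j ∧ B₁ i j = A₁ᴴ i j := by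
      intro i j
      have e1 := congrFun (congrFun h1 i) j
      have e2 := congrFun (congrFun h2 i) j
      have e3 := congrFun (congrFun h3 i) j
      simp only [add_apply, neg_apply, smul_apply, smul_eq_mul] at e1 e2 e3
      have e4 : B₁ᴴ i j - A₁ᴴ i j = A₁ i j - B₁ i j :=
        mul_left_cancel₀ Complex.I_ne_zero (by linear_combination e3 - (e1 + e2) / 2)
      exact ⟨by linear_combination (e1 + e2) / 2,
        by linear_combination -((e1 - e2) / 4 - e4 / 2)⟩
    exact ⟨by ext i j; exact (h4 i j).1, by ext i j; exact (h4 i j).2⟩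
  obtain ⟨hA₀, rfl⟩ := hherm
  -- One `δ` makes the Schur complements definite; the other absorbs the error of the averaging.
  obtain ⟨δ, hδ, rfl⟩ : ∃ δ : ℝ, 0 < δ ∧ ε = δ + δ := ⟨ε / 2, by positivity, by ring⟩
  set A : Matrix (Fin n) (Fin n) ℂ := A₀ + (δ : ℂ) • 1 with hA
  have hAH : A.IsHermitian := by
    refine hA₀.add ?_
    rw [IsHermitian, conjTranspose_smul, conjTranspose_one]
    simp
  have hpd : ∀ k, (schurSeq A A₁ k).PosDef := fun k => by
    refine (schurSeq_posDef hδ hAH (fun N x => ?_) k).1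
    have h1 := toeplitz_nonneg h N x
    have h2 : ∀ y, sesq A y y = sesq A₀ y y + (δ : ℂ) * (star y ⬝ᵥ y) := fun y => by
      rw [hA, sesq_add, sesq_smul, sesq_apply 1, one_mulVec]
    have hδ' : (0 : ℂ) ≤ δ := by rw [Complex.zero_le_real]; exact hδ.le
    simp only [h2, Finset.sum_add_distrib] at h1 ⊢
    have h3 : (δ : ℂ) * (star (x N) ⬝ᵥ x N) ≤
        ∑ k ∈ Finset.range (N + 1), (δ : ℂ) * (star (x k) ⬝ᵥ x k) :=
      Finset.single_le_sum (f := fun k => (δ : ℂ) * (star (x k) ⬝ᵥ x k))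
        (fun k _ => mul_nonneg hδ' (dotProduct_star_self_nonneg _))
        (Finset.mem_range.2 (Nat.lt_succ_self N))
    refine h3.trans (sub_nonneg.1 (h1.trans_eq ?_))
    ring
  obtain ⟨c, hc⟩ := hAH.exists_smul_one_sub_posSemidef
  -- Since `A ≤ c` and `c ≤ δ m`, the correction `δ - A / m` added to `P` below is positive.
  obtain ⟨m, hm⟩ := exists_nat_gt (max 0 (c / δ))
  have hm0 : (0 : ℝ) < m := lt_of_le_of_lt (le_max_left _ _) hm
  have hmc : c ≤ δ * m := by
    have := (le_max_right 0 (c / δ)).trans hm.le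
    rwa [div_le_iff₀ hδ, mul_comm] at this
  have hm0' : (m : ℂ) ≠ 0 := by exact_mod_cast hm0.ne'
  have hminv : (0 : ℂ) ≤ (m : ℂ)⁻¹ := by
    have : ((m : ℂ)⁻¹) = (((m : ℝ)⁻¹ : ℝ) : ℂ) := by push_cast; rfl
    rw [this, Complex.zero_le_real]
    positivity
  -- Telescoping, because `A₁ S_k⁻¹ A₁ᴴ = A - S_{k+1}` for the Schur complements `S_k`.
  have htel : ∀ m : ℕ, ∑ k ∈ Finset.range m,
      (A₁ * (schurSeq A A₁ k)⁻¹ * A₁ᴴ + schurSeq A A₁ k) + schurSeq A A₁ m =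
        ((m : ℂ) + 1) • A := by
    intro m
    induction m with
    | zero => simp [schurSeq]
    | succ m ih =>
      rw [Finset.sum_range_succ, schurSeq]
      have : ((m + 1 : ℕ) : ℂ) + 1 = ((m : ℂ) + 1) + 1 := by push_cast; ring
      rw [this, add_smul, ← ih, one_smul]
      abel
  -- The average over `k < m` of the blocks `[[A₁ S_k⁻¹ A₁ᴴ, A₁], [A₁ᴴ, S_k]]`. With `S_m / m` added
  -- to the first corner the diagonal sums to `A + A / m`, and the correction turns this into `A + δ
  -- = A₀ + 2δ`.
  refine ⟨(m : ℂ)⁻¹ • (∑ k ∈ Finset.range m, A₁ * (schurSeq A A₁ k)⁻¹ * A₁ᴴ + schurSeq A A₁ m) +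
      ((δ : ℂ) • 1 - (m : ℂ)⁻¹ • A), (m : ℂ)⁻¹ • ∑ k ∈ Finset.range m, schurSeq A A₁ k, ?_, ?_⟩
  · have h1 := congrArg ((m : ℂ)⁻¹ • ·) (htel m)
    simp only [Finset.sum_add_distrib, smul_smul, smul_add,
      inv_mul_cancel₀ hm0', add_smul, one_smul] at h1
    simp only [smul_add]
    have h2 : ((δ + δ : ℝ) : ℂ) • (1 : Matrix (Fin n) (Fin n) ℂ) = (δ : ℂ) • 1 + (δ : ℂ) • 1 := by
      push_cast
      rw [add_smul]
    rw [h2, ← add_assoc, ← hA]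
    calc _ = ((m : ℂ)⁻¹ • ∑ k ∈ Finset.range m, A₁ * (schurSeq A A₁ k)⁻¹ * A₁ᴴ +
          (m : ℂ)⁻¹ • ∑ k ∈ Finset.range m, schurSeq A A₁ k + (m : ℂ)⁻¹ • schurSeq A A₁ m) +
          ((δ : ℂ) • 1 - (m : ℂ)⁻¹ • A) := by abel
      _ = _ := by rw [h1]; abel
  · intro x y
    have h1 : 0 ≤ ∑ k ∈ Finset.range m, (sesq (A₁ * (schurSeq A A₁ k)⁻¹ * A₁ᴴ) x x +
        sesq A₁ x y + sesq A₁ᴴ y x + sesq (schurSeq A A₁ k) y y) :=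
      Finset.sum_nonneg fun k _ => schur_block_nonneg (hpd k) x y
    have h2 := (hpd m).posSemidef.sesq_nonneg x
    have h3 : 0 ≤ sesq ((δ : ℂ) • 1 - (m : ℂ)⁻¹ • A) x x := by
      have h4 := hc.sesq_nonneg x
      have h5 : (0 : ℂ) ≤ ((δ * m - c : ℝ) : ℂ) * (star x ⬝ᵥ x) := by
        refine mul_nonneg ?_ (dotProduct_star_self_nonneg _)
        rw [Complex.zero_le_real]
        linarith
      have h6 : sesq ((δ : ℂ) • 1 - (m : ℂ)⁻¹ • A) x x = (m : ℂ)⁻¹ *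
          (((δ * m - c : ℝ) : ℂ) * (star x ⬝ᵥ x) + sesq ((c : ℂ) • 1 - A) x x) := by
        rw [sesq_sub, sesq_sub, sesq_smul, sesq_smul, sesq_smul, sesq_apply 1, one_mulVec]
        push_cast
        field_simp
        ring
      rw [h6]
      exact mul_nonneg hminv (add_nonneg h5 h4)
    refine (add_nonneg (mul_nonneg hminv (add_nonneg h1 h2)) h3).trans_eq ?_
    simp only [sesq_add, sesq_smul, sesq_sum, Finset.sum_add_distrib, Finset.sum_const,
      Finset.card_range, nsmul_eq_mul]
    field_simp
    ring

end Matrix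

/-! ### The complete quotient map `M_2 → S({-1, 0, 1})` -/

theorem circleUnitary_ofAdd_apply (k : ℤ) (ζ : Circle) :
    (circleUnitary (Multiplicative.ofAdd k) : C(Circle, ℂ)) ζ = (ζ : ℂ) ^ k := by
  have h0 : ∀ m : ℕ, (circleUnitary (Multiplicative.ofAdd (m : ℤ)) : C(Circle, ℂ)) ζ =
      (ζ : ℂ) ^ m := fun m => by
    have h1 : circleUnitary (Multiplicative.ofAdd (m : ℤ)) = circleCoord ^ m := by
      simp [circleUnitary, zpowersHom_apply]
    rw [h1, SubmonoidClass.coe_pow, ContinuousMap.pow_apply]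
    rfl
  cases k with
  | ofNat m => exact_mod_cast h0 m
  | negSucc m =>
    have h1 : circleUnitary (Multiplicative.ofAdd ((m + 1 : ℕ) : ℤ)) *
        circleUnitary (Multiplicative.ofAdd (Int.negSucc m)) = 1 := by
      rw [← map_mul, ← ofAdd_add, Int.negSucc_eq]
      simp
    have h2 := DFunLike.congr_fun (congrArg Subtype.val h1) ζ
    rw [Submonoid.coe_mul, ContinuousMap.mul_apply, h0] at h2
    rw [zpow_negSucc]
    exact eq_inv_of_mul_eq_one_right h2

namespace SZ

/-- The `(a, b)` entry of a matrix in `M_2`. -/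
def entry (a b : Fin 2) : MTwo →ₗ[ℂ] ℂ where
  toFun y := (y : CStarMatrix (Fin 2) (Fin 2) ℂ) a b
  map_add' _ _ := rfl
  map_smul' _ _ := rfl

/-- The map `M_2 → S({-1, 0, 1})`, `E_{aa} ↦ 1 / 2`, `E_{01} ↦ u_1 / 2`, `E_{10} ↦ u_{-1} / 2`. -/
noncomputable def quotientMap : MTwo →ₗ[ℂ] SZ :=
  ((1 / 2 : ℂ) • (entry 0 0 + entry 1 1)).smulRight SZ.unit +
    ((1 / 2 : ℂ) • entry 0 1).smulRight
      ⟨circleUnitary (Multiplicative.ofAdd 1), Submodule.subset_span ⟨_, by simp [zSet], rfl⟩⟩ +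
    ((1 / 2 : ℂ) • entry 1 0).smulRight
      ⟨circleUnitary (Multiplicative.ofAdd (-1)), Submodule.subset_span ⟨_, by simp [zSet], rfl⟩⟩

theorem quotientMap_apply (y : MTwo) (ζ : Circle) :
    (quotientMap y : C(Circle, ℂ)) ζ =
      (entry 0 0 y + entry 1 1 y + entry 0 1 y * ζ + entry 1 0 y * (ζ : ℂ)⁻¹) / 2 := by
  have h1 : (quotientMap y : C(Circle, ℂ)) =
      (1 / 2 * (entry 0 0 y + entry 1 1 y) : ℂ) • (1 : C(Circle, ℂ)) +
        (1 / 2 * entry 0 1 y : ℂ) • (circleUnitary (Multiplicative.ofAdd 1) : C(Circle, ℂ)) +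
        (1 / 2 * entry 1 0 y : ℂ) • (circleUnitary (Multiplicative.ofAdd (-1)) : C(Circle, ℂ)) :=
    rfl
  rw [h1]
  simp only [ContinuousMap.add_apply, ContinuousMap.smul_apply, circleUnitary_ofAdd_apply,
    ContinuousMap.one_apply, smul_eq_mul, zpow_one, zpow_neg]
  ring

theorem quotientMap_eq_iff (y y' : MTwo) : quotientMap y = quotientMap y' ↔
    entry 0 0 y + entry 1 1 y = entry 0 0 y' + entry 1 1 y' ∧ entry 0 1 y = entry 0 1 y' ∧
      entry 1 0 y = entry 1 0 y' := by
  constructor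
  · intro h
    have h1 : ∀ ζ : Circle, _ := fun ζ =>
      ((quotientMap_apply y ζ).symm.trans (by rw [h])).trans (quotientMap_apply y' ζ)
    have e1 := h1 1
    have e2 := h1 (-1)
    have e3 := h1 ⟨Complex.I, by simp [Submonoid.unitSphere]⟩
    simp only [Circle.coe_one, Circle.coe_neg, inv_neg, inv_one, Complex.inv_I] at e1 e2 e3
    have e4 : entry 0 1 y - entry 1 0 y = entry 0 1 y' - entry 1 0 y' :=
      mul_left_cancel₀ Complex.I_ne_zero (by linear_combination 2 * e3 - (e1 + e2))
    refine ⟨?_, ?_, ?_⟩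
    · linear_combination e1 + e2
    · linear_combination (e1 - e2 + e4) / 2
    · linear_combination (e1 - e2 - e4) / 2
  · rintro ⟨h1, h2, h3⟩
    apply Subtype.ext
    ext ζ
    rw [quotientMap_apply, quotientMap_apply, h1, h2, h3]

/-- The matrix `[[a, b], [c, d]]` as an element of the operator system `M_2`. -/
def mk (a b c d : ℂ) : MTwo := ⟨CStarMatrix.ofMatrix !![a, b; c, d], Submodule.mem_top⟩

@[simp] theorem entry_mk_zero_zero (a b c d : ℂ) : entry 0 0 (mk a b c d) = a := rfl
@[simp] theorem entry_mk_zero_one (a b c d : ℂ) : entry 0 1 (mk a b c d) = b := rfl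
@[simp] theorem entry_mk_one_zero (a b c d : ℂ) : entry 1 0 (mk a b c d) = c := rfl
@[simp] theorem entry_mk_one_one (a b c d : ℂ) : entry 1 1 (mk a b c d) = d := rfl

theorem unit_eq_mk : MTwo.unit = mk 1 0 0 1 := by
  apply Subtype.ext
  ext i j
  fin_cases i <;> fin_cases j <;> rfl

theorem quotientMap_surjective : Function.Surjective quotientMap := by
  rintro ⟨T, hT⟩
  suffices ∃ y, (quotientMap y : C(Circle, ℂ)) = T by
    obtain ⟨y, hy⟩ := this
    exact ⟨y, Subtype.ext hy⟩
  induction hT using Submodule.span_induction with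
  | mem T hT =>
    obtain ⟨g, hg, rfl⟩ := hT
    rcases hg with rfl | rfl | rfl
    · refine ⟨mk 0 0 2 0, ?_⟩
      ext ζ
      rw [quotientMap_apply, circleUnitary_ofAdd_apply]
      simp
    · refine ⟨mk 1 0 0 1, ?_⟩
      ext ζ
      rw [quotientMap_apply, circleUnitary_ofAdd_apply]
      norm_num
    · refine ⟨mk 0 2 0 0, ?_⟩
      ext ζ
      rw [quotientMap_apply, circleUnitary_ofAdd_apply]
      simp
  | zero => exact ⟨0, by simp⟩
  | add T U _ _ hT hU =>
    obtain ⟨y, rfl⟩ := hT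
    obtain ⟨y', rfl⟩ := hU
    exact ⟨y + y', by simp⟩
  | smul r T _ hT =>
    obtain ⟨y, rfl⟩ := hT
    exact ⟨r • y, by simp⟩

theorem isUCP_quotientMap : OpSystem.IsUCP quotientMap where
  map_unit := by
    apply Subtype.ext
    ext ζ
    rw [quotientMap_apply, unit_eq_mk]
    simp [OpSystem.unit]
  map_pos n X hX := by
    obtain ⟨B, hB⟩ := hX
    -- The two rows of `B` applied to the vector `(1, ζ)/√2`, whose vector state is the quotient map
    -- at `ζ`.
    let R : Fin 2 → Matrix (Fin n) (Fin n) C(Circle, ℂ) := fun a => Matrix.of fun k j =>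
      ⟨fun ζ : Circle => (B k j a 0 + B k j a 1 * ζ) * ((Real.sqrt 2 : ℝ) : ℂ)⁻¹, by fun_prop⟩
    have h : (X.map quotientMap).map (fun s : SZ => (s : C(Circle, ℂ))) =
        (R 0).conjTranspose * R 0 + (R 1).conjTranspose * R 1 := by
      ext i j ζ
      have hc : (starRingEnd ℂ) (ζ : ℂ) = (ζ : ℂ)⁻¹ := by
        rw [← Circle.coe_inv_eq_conj, Circle.coe_inv]
      have hζ : (ζ : ℂ) ≠ 0 := Circle.coe_ne_zero ζ
      have hX : ∀ a b, entry a b (X i j) = ∑ k, ∑ c, star (B k i c a) * B k j c b := by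
        intro a b
        have h1 := congrFun (congrFun hB i) j
        rw [Matrix.mul_apply] at h1
        have h2 : entry a b (X i j) = (∑ k, B.conjTranspose i k * B k j) a b := by rw [← h1]; rfl
        rw [h2]
        have h3 : ∀ s : Finset (Fin n), (∑ k ∈ s, B.conjTranspose i k * B k j) a b =
            ∑ k ∈ s, (B.conjTranspose i k * B k j) a b := fun s => by
          induction s using Finset.induction_on with
          | empty => rfl
          | insert k s hk ih =>
            rw [Finset.sum_insert hk, Finset.sum_insert hk, CStarMatrix.add_apply, ih]
        rw [h3]
        refine Finset.sum_congr rfl fun k _ => ?_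
        rw [CStarMatrix.mul_apply]
        refine Finset.sum_congr rfl fun c _ => ?_
        rw [Matrix.conjTranspose_apply, CStarMatrix.star_apply]
      have hs : ((Real.sqrt 2 : ℝ) : ℂ)⁻¹ * ((Real.sqrt 2 : ℝ) : ℂ)⁻¹ = 1 / 2 := by
        rw [← mul_inv, ← Complex.ofReal_mul, Real.mul_self_sqrt (by norm_num)]
        norm_num
      rw [Matrix.map_apply, Matrix.map_apply, quotientMap_apply, hX, hX, hX, hX, Matrix.add_apply,
        Matrix.mul_apply, Matrix.mul_apply, ContinuousMap.add_apply, ContinuousMap.sum_apply,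
        ContinuousMap.sum_apply]
      simp only [Fin.sum_univ_two, Finset.sum_mul, ← Finset.sum_add_distrib, Finset.sum_div]
      refine Finset.sum_congr rfl fun k _ => ?_
      have hR : ∀ a k j, R a k j ζ = (B k j a 0 + B k j a 1 * ζ) * ((Real.sqrt 2 : ℝ) : ℂ)⁻¹ :=
        fun _ _ _ => rfl
      simp only [Matrix.conjTranspose_apply, ContinuousMap.mul_apply, ContinuousMap.star_apply, hR,
        Complex.star_def, map_mul, map_add, hc, map_inv₀, Complex.conj_ofReal]
      have hζ1 := inv_mul_cancel₀ hζ
      linear_combination -(((starRingEnd ℂ) (B k i 0 0) + (starRingEnd ℂ) (B k i 0 1) * (ζ : ℂ)⁻¹) *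
        (B k j 0 0 + B k j 0 1 * ζ) +
        ((starRingEnd ℂ) (B k i 1 0) + (starRingEnd ℂ) (B k i 1 1) * (ζ : ℂ)⁻¹) *
        (B k j 1 0 + B k j 1 1 * ζ)) * hs - ((starRingEnd ℂ) (B k i 0 1) * B k j 0 1 +
        (starRingEnd ℂ) (B k i 1 1) * B k j 1 1) / 2 * hζ1
    rw [OpSystem.IsPos, h]
    exact IsPosMatrix.add ⟨R 0, rfl⟩ ⟨R 1, rfl⟩

end SZ

/-! ### Quotient cones and approximate positive lifts. -/

theorem OpSystem.IsUCP.isPos_of_isQuotientPos {A : Type u} [CStarAlgebra A] {B : Type v}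
    [CStarAlgebra B] {S : OpSystem A} {T : OpSystem B} {φ : S →ₗ[ℂ] T} (hφ : IsUCP φ) {n : ℕ}
    {X : Matrix (Fin n) (Fin n) (S ⧸ LinearMap.ker φ)} (hX : IsQuotientPos φ X) :
    T.IsPos (X.map ((LinearMap.ker φ).liftQ φ le_rfl)) := by
  refine IsPosMatrix.of_forall_add_smul_one fun ε hε => ?_
  obtain ⟨Y, hY, hYX⟩ := hX ε hε
  have h1 := hφ.map_pos n Y hY
  rw [OpSystem.IsPos] at h1
  convert h1 using 1
  ext1 i j
  have h2 := congrArg ((LinearMap.ker φ).liftQ φ le_rfl) (congrFun (congrFun hYX i) j)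
  simp only [Matrix.map_apply, Matrix.add_apply, Matrix.smul_apply, map_add, map_smul,
    Submodule.mkQ_apply, Submodule.liftQ_apply] at h2 ⊢
  rw [h2]
  by_cases hij : i = j
  · subst hij
    rw [Matrix.diagonal_apply_eq, Submodule.liftQ_apply, hφ.map_unit, Matrix.one_apply_eq]
    rfl
  · simp [hij]

theorem OpSystem.IsCompleteQuotientMap.exists_lift {A : Type u} [CStarAlgebra A] {B : Type v}
    [CStarAlgebra B] {S : OpSystem A} {T : OpSystem B} {φ : S →ₗ[ℂ] T}
    (hφ : IsCompleteQuotientMap φ) {n : ℕ} {X : Matrix (Fin n) (Fin n) S}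
    (hX : T.IsPos (X.map φ)) {ε : ℝ} (hε : 0 < ε) :
    ∃ Y : Matrix (Fin n) (Fin n) S, S.IsPos Y ∧
      ∀ i j, φ (Y i j) = φ (X i j) + if i = j then (ε : ℂ) • T.unit else 0 := by
  obtain ⟨Y, hY, hYX⟩ := (hφ.order_iso n (X.map (LinearMap.ker φ).mkQ)).2 hX ε hε
  refine ⟨Y, hY, fun i j => ?_⟩
  have h1 := congrArg ((LinearMap.ker φ).liftQ φ le_rfl) (congrFun (congrFun hYX i) j)
  rw [Matrix.add_apply, Matrix.smul_apply, Matrix.map_apply, Matrix.map_apply, map_add, map_smul,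
    Submodule.mkQ_apply, Submodule.mkQ_apply, Submodule.liftQ_apply, Submodule.liftQ_apply] at h1
  rw [h1]
  congr 1
  by_cases hij : i = j
  · subst hij
    rw [Matrix.diagonal_apply_eq, Submodule.mkQ_apply, Submodule.liftQ_apply, hφ.ucp.map_unit,
      if_pos rfl]
  · simp [hij]

namespace SZ

theorem isCompleteQuotientMap_quotientMap : OpSystem.IsCompleteQuotientMap quotientMap where
  ucp := isUCP_quotientMap
  surjective := quotientMap_surjective
  order_iso n X := by
    refine ⟨isUCP_quotientMap.isPos_of_isQuotientPos, fun h ε hε => ?_⟩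
    choose Z hZ using fun i j => Submodule.mkQ_surjective (LinearMap.ker quotientMap) (X i j)
    obtain ⟨F, hF⟩ := h
    have hF' : ∀ i j ζ, (quotientMap (Z i j) : C(Circle, ℂ)) ζ = (F.conjTranspose * F) i j ζ := by
      intro i j ζ
      rw [← hF, Matrix.map_apply, Matrix.map_apply, ← hZ, Submodule.mkQ_apply, Submodule.liftQ_apply]
    -- The image of `Z`, read as a matrix-valued polynomial in `ζ`; it is positive at each point as
    -- `F(ζ)ᴴ F(ζ)`.
    obtain ⟨P, Q, hPQ, hpos⟩ := Matrix.exists_block_decomposition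
      (A₀ := Matrix.of fun i j => (entry 0 0 (Z i j) + entry 1 1 (Z i j)) / 2)
      (A₁ := Matrix.of fun i j => entry 0 1 (Z i j) / 2)
      (B₁ := Matrix.of fun i j => entry 1 0 (Z i j) / 2) (fun ζ => by
        convert Matrix.posSemidef_conjTranspose_mul_self (F.map fun f => f ζ) using 1
        ext i j
        have h1 := hF' i j ζ
        rw [quotientMap_apply, Matrix.mul_apply, ContinuousMap.sum_apply] at h1
        rw [Matrix.mul_apply]
        simp only [Matrix.conjTranspose_apply, ContinuousMap.mul_apply, ContinuousMap.star_apply,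
          Matrix.map_apply, Matrix.add_apply, Matrix.smul_apply, Matrix.of_apply,
          smul_eq_mul] at h1 ⊢
        rw [← h1]
        ring) hε
    -- The factors 2 undo the `1 / 2` in the quotient map: `2P + 2Q` is the trace of `Z` plus `2ε`,
    -- the trace of `Z + ε`.
    refine ⟨Matrix.of fun i j => mk (2 * P i j) (entry 0 1 (Z i j)) (entry 1 0 (Z i j))
      (2 * Q i j), ?_, ?_⟩
    · rw [OpSystem.IsPos, IsPosMatrix.iff_quadratic_nonneg]
      intro v
      have h1 := hpos (fun i => v i 0) (fun i => v i 1)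
      have h2 := mul_nonneg (zero_le_two : (0 : ℂ) ≤ 2) h1
      refine h2.trans_eq ?_
      simp only [Matrix.sesq_eq_sum, ← Finset.sum_add_distrib, Finset.mul_sum]
      refine Finset.sum_congr rfl fun i _ => Finset.sum_congr rfl fun j _ => ?_
      have hmk : ∀ a b c d : ℂ, (mk a b c d : CStarMatrix (Fin 2) (Fin 2) ℂ) 0 0 = a ∧
          (mk a b c d : CStarMatrix (Fin 2) (Fin 2) ℂ) 0 1 = b ∧
          (mk a b c d : CStarMatrix (Fin 2) (Fin 2) ℂ) 1 0 = c ∧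
          (mk a b c d : CStarMatrix (Fin 2) (Fin 2) ℂ) 1 1 = d :=
        fun _ _ _ _ => ⟨rfl, rfl, rfl, rfl⟩
      simp only [Fin.sum_univ_two, Matrix.map_apply, Matrix.of_apply, hmk]
      ring
    · ext1 i j
      rw [Matrix.map_apply, Matrix.add_apply, ← hZ, Matrix.smul_apply, Matrix.of_apply]
      have h1 : (Matrix.diagonal fun _ : Fin n =>
          (LinearMap.ker quotientMap).mkQ (OpSystem.unit MTwo)) i j =
          (LinearMap.ker quotientMap).mkQ (if i = j then OpSystem.unit MTwo else 0) := by
        by_cases hij : i = j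
        · subst hij; simp
        · simp [hij]
      rw [h1, ← map_smul, ← map_add, ← sub_eq_zero, ← map_sub, Submodule.mkQ_apply,
        Submodule.Quotient.mk_eq_zero, LinearMap.sub_mem_ker_iff, quotientMap_eq_iff]
      have h2 := congrFun (congrFun hPQ i) j
      simp only [Matrix.add_apply, Matrix.of_apply, Matrix.smul_apply, smul_eq_mul] at h2
      rw [unit_eq_mk]
      by_cases hij : i = j
      · subst hij
        simp only [Matrix.one_apply_eq] at h2
        simp only [if_true, map_add, map_smul, entry_mk_zero_zero, entry_mk_zero_one,
          entry_mk_one_zero, entry_mk_one_one, smul_eq_mul]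
        refine ⟨?_, by ring, by ring⟩
        linear_combination 2 * h2
      · simp only [Matrix.one_apply_ne hij] at h2
        simp only [if_neg hij, map_add, map_smul, entry_mk_zero_zero, entry_mk_zero_one,
          entry_mk_one_zero, entry_mk_one_one, map_zero, smul_eq_mul]
        refine ⟨?_, by ring, by ring⟩
        linear_combination 2 * h2

end SZ

/-! ### The induced map on the crossed products by `ℤ` -/

namespace SZ

/-- A self-adjoint `2 × 2` matrix with constant diagonal `3` and off-diagonal entries of absolute
value at most `3` is positive. -/
theorem isPosMatrix_of_norm_sq_le (p : C(Circle, ℂ)) (hp : ∀ ζ, ‖p ζ‖ ^ 2 ≤ 9) :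
    IsPosMatrix !![(3 : C(Circle, ℂ)), p; star p, 3] := by
  -- Cholesky factorisation over `C(𝕋)`, with upper triangular factor `[[√3, p/√3], [0, √(3 -
  -- |p|²/3)]]`.
  let s3 : C(Circle, ℂ) := ContinuousMap.const _ ((Real.sqrt 3 : ℝ) : ℂ)
  let r3 : C(Circle, ℂ) := ContinuousMap.const _ ((Real.sqrt 3 : ℝ) : ℂ)⁻¹
  let q : C(Circle, ℂ) := ⟨fun ζ => ((Real.sqrt (3 - ‖p ζ‖ ^ 2 / 3) : ℝ) : ℂ), by fun_prop⟩
  have h33 : ((Real.sqrt 3 : ℝ) : ℂ) * ((Real.sqrt 3 : ℝ) : ℂ) = 3 := by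
    rw [← Complex.ofReal_mul, Real.mul_self_sqrt (by norm_num)]
    norm_num
  have h3 : ((Real.sqrt 3 : ℝ) : ℂ) ≠ 0 := fun h => by simp [h] at h33
  have hs : star s3 = s3 := by ext ζ; simp [s3]
  have hr : star r3 = r3 := by ext ζ; simp [r3]
  have hq : star q = q := by
    ext ζ
    exact Complex.conj_ofReal _
  have h3r : s3 * r3 = 1 := by ext ζ; simp [s3, r3, h3]
  have h3s : s3 * s3 = 3 := by ext ζ; exact h33
  have hqq : r3 * star p * (r3 * p) + q * q = 3 := by
    ext ζ
    have e1 : q ζ * q ζ = ((3 - ‖p ζ‖ ^ 2 / 3 : ℝ) : ℂ) := by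
      change ((Real.sqrt (3 - ‖p ζ‖ ^ 2 / 3) : ℝ) : ℂ) *
        ((Real.sqrt (3 - ‖p ζ‖ ^ 2 / 3) : ℝ) : ℂ) = _
      rw [← Complex.ofReal_mul, Real.mul_self_sqrt (by linarith [hp ζ])]
    have e2 : star (p ζ) * p ζ = ((‖p ζ‖ ^ 2 : ℝ) : ℂ) := by
      rw [Complex.star_def, Complex.conj_mul']
      push_cast
      rfl
    have e3 : r3 ζ * r3 ζ = 1 / 3 := by
      change ((Real.sqrt 3 : ℝ) : ℂ)⁻¹ * ((Real.sqrt 3 : ℝ) : ℂ)⁻¹ = 1 / 3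
      rw [← mul_inv, h33]
      norm_num
    have e4 : (3 : C(Circle, ℂ)) ζ = 3 := rfl
    simp only [ContinuousMap.add_apply, ContinuousMap.mul_apply, ContinuousMap.star_apply, e4]
    rw [e1]
    push_cast at e2 ⊢
    linear_combination (1 / 3 : ℂ) * e2 + star (p ζ) * p ζ * e3
  refine ⟨!![s3, r3 * p; 0, q], ?_⟩
  ext1 i j
  fin_cases i <;> fin_cases j
  · simp [Matrix.mul_apply, hs, h3s]
  · simp [Matrix.mul_apply, hs, ← mul_assoc, h3r]
  · simp [Matrix.mul_apply, hr, mul_assoc, mul_comm r3, h3r]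
  · simp [Matrix.mul_apply, hr, hq, hqq]

/-- The element `a λ_{-1} + b λ_0 + c λ_1` of the crossed product. -/
noncomputable def trig {A : Type*} [CStarAlgebra A] {S : OpSystem A}
    {C : Type*} [CStarAlgebra C] {H : Type*} [NormedAddCommGroup H] [InnerProductSpace ℂ H]
    [CompleteSpace H] (𝒞 : AdmissibleCover S (1 : Multiplicative ℤ →* S.Aut) C)
    (π : FaithfulRep C H) (a b c : S) : 𝒞.crossedProduct π zSet_isGeneratingSet :=
  𝒞.coeffEquiv π zSet_isGeneratingSet
    (Finsupp.single ⟨Multiplicative.ofAdd (-1), by simp [zSet]⟩ a +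
      Finsupp.single ⟨Multiplicative.ofAdd 0, by simp [zSet]⟩ b +
      Finsupp.single ⟨Multiplicative.ofAdd 1, by simp [zSet]⟩ c)

theorem evalAt_trig {A : Type*} [CStarAlgebra A] {S : OpSystem A}
    {C : Type*} [CStarAlgebra C] {H : Type*} [NormedAddCommGroup H] [InnerProductSpace ℂ H]
    [CompleteSpace H] (𝒞 : AdmissibleCover S (1 : Multiplicative ℤ →* S.Aut) C)
    (π : FaithfulRep C H) (a b c : S) (w : Circle) :
    𝒞.evalAt π zSet_isGeneratingSet w (trig 𝒞 π a b c) = (w : ℂ)⁻¹ • a + b + (w : ℂ) • c := by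
  rw [trig, map_add, map_add, map_add, map_add, AdmissibleCover.evalAt_coeffEquiv_single,
    AdmissibleCover.evalAt_coeffEquiv_single, AdmissibleCover.evalAt_coeffEquiv_single]
  simp

theorem exists_eq_trig {A : Type*} [CStarAlgebra A] {S : OpSystem A}
    {C : Type*} [CStarAlgebra C] {H : Type*} [NormedAddCommGroup H] [InnerProductSpace ℂ H]
    [CompleteSpace H] (𝒞 : AdmissibleCover S (1 : Multiplicative ℤ →* S.Aut) C)
    (π : FaithfulRep C H) (x : 𝒞.crossedProduct π zSet_isGeneratingSet) :
    ∃ a b c : S, x = trig 𝒞 π a b c := by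
  obtain ⟨f, rfl⟩ := (𝒞.coeffEquiv π zSet_isGeneratingSet).surjective x
  induction f using Finsupp.induction_linear with
  | zero => exact ⟨0, 0, 0, by simp [trig]⟩
  | add f g hf hg =>
    obtain ⟨a, b, c, h⟩ := hf
    obtain ⟨a', b', c', h'⟩ := hg
    refine ⟨a + a', b + b', c + c', ?_⟩
    rw [map_add, h, h', trig, trig, trig, ← map_add]
    congr 1
    simp only [Finsupp.single_add]
    abel
  | single g s =>
    obtain ⟨g, hg⟩ := g
    rcases hg with rfl | rfl | rfl
    · exact ⟨s, 0, 0, by simp [trig]⟩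
    · exact ⟨0, s, 0, by simp [trig]⟩
    · exact ⟨0, 0, s, by simp [trig]⟩

/-- The imaginary unit as a point of the circle. -/
noncomputable def circleI : Circle := ⟨Complex.I, by simp [Submonoid.unitSphere]⟩

/-- Both sides are twice the constant coefficient, as the terms of degree `±1` are odd in `w`. This
is where the restriction to the generating set `{-1, 0, 1}` enters the obstruction. -/
theorem evalAt_add_evalAt_neg {A : Type*} [CStarAlgebra A] {S : OpSystem A}
    {C : Type*} [CStarAlgebra C] {H : Type*} [NormedAddCommGroup H] [InnerProductSpace ℂ H]
    [CompleteSpace H] (𝒞 : AdmissibleCover S (1 : Multiplicative ℤ →* S.Aut) C)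
    (π : FaithfulRep C H) (x : 𝒞.crossedProduct π zSet_isGeneratingSet) :
    𝒞.evalAt π zSet_isGeneratingSet 1 x + 𝒞.evalAt π zSet_isGeneratingSet (-1) x =
      𝒞.evalAt π zSet_isGeneratingSet circleI x +
        𝒞.evalAt π zSet_isGeneratingSet (-circleI) x := by
  obtain ⟨a, b, c, rfl⟩ := exists_eq_trig 𝒞 π x
  simp only [evalAt_trig, Circle.coe_neg, Circle.coe_one, inv_neg, inv_one, neg_smul]
  abel

/-! ### A positive element without approximate positive lifts. -/

section

variable {C : Type*} [CStarAlgebra C]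
  (𝒞 : AdmissibleCover MTwo (1 : Multiplicative ℤ →* MTwo.Aut) C)
  {H : Type*} [NormedAddCommGroup H] [InnerProductSpace ℂ H] [CompleteSpace H]
  (π : FaithfulRep C H)

/-- A matrix over `M_2 ⋊ ℤ` whose image over `S({-1, 0, 1}) ⋊ ℤ` is
`[[3, p], [p*, 3]]` with `p = z w + z w⁻¹ + z⁻¹ w - z⁻¹ w⁻¹`. -/
noncomputable def witness :
    Matrix (Fin 2) (Fin 2) (𝒞.crossedProduct π zSet_isGeneratingSet) :=
  !![trig 𝒞 π 0 (mk 3 0 0 3) 0, trig 𝒞 π (mk 0 2 (-2) 0) 0 (mk 0 2 2 0);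
    trig 𝒞 π (mk 0 2 2 0) 0 (mk 0 (-2) 2 0), trig 𝒞 π 0 (mk 3 0 0 3) 0]

theorem isPos_witness (w : Circle) : SZ.IsPos
    (((witness 𝒞 π).map (𝒞.evalAt π zSet_isGeneratingSet w)).map quotientMap) := by
  let p : C(Circle, ℂ) := ⟨fun ζ => (ζ : ℂ) * (w + (w : ℂ)⁻¹) + (ζ : ℂ)⁻¹ * (w - (w : ℂ)⁻¹), by
    have : ∀ ζ : Circle, (ζ : ℂ)⁻¹ = ((ζ⁻¹ : Circle) : ℂ) := fun ζ => (Circle.coe_inv ζ).symm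
    simp only [this]
    fun_prop⟩
  have hc : ∀ ζ : Circle, (starRingEnd ℂ) (ζ : ℂ) = (ζ : ℂ)⁻¹ := fun ζ => by
    rw [← Circle.coe_inv_eq_conj, Circle.coe_inv]
  have hp : ∀ ζ, ‖p ζ‖ ^ 2 ≤ 9 := by
    intro ζ
    have hw : (w : ℂ) ≠ 0 := Circle.coe_ne_zero w
    -- Two numbers whose squares add up to 4 have sum at most `2√2`, so in fact `|p|² ≤ 8`.
    have hpar : ‖(w : ℂ) + (w : ℂ)⁻¹‖ ^ 2 + ‖(w : ℂ) - (w : ℂ)⁻¹‖ ^ 2 = 4 := by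
      have := parallelogram_law_with_norm ℝ (w : ℂ) ((w : ℂ)⁻¹)
      rw [norm_inv, Circle.norm_coe] at this
      nlinarith
    have hle : ‖p ζ‖ ≤ ‖(w : ℂ) + (w : ℂ)⁻¹‖ + ‖(w : ℂ) - (w : ℂ)⁻¹‖ := by
      refine (norm_add_le _ _).trans_eq ?_
      rw [norm_mul, norm_mul, norm_inv, Circle.norm_coe]
      simp
    nlinarith [norm_nonneg (p ζ), sq_nonneg (‖(w : ℂ) + (w : ℂ)⁻¹‖ - ‖(w : ℂ) - (w : ℂ)⁻¹‖),
      norm_nonneg ((w : ℂ) + (w : ℂ)⁻¹), norm_nonneg ((w : ℂ) - (w : ℂ)⁻¹)]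
  rw [OpSystem.IsPos]
  convert isPosMatrix_of_norm_sq_le p hp using 1
  ext i j ζ
  rw [Matrix.map_apply, Matrix.map_apply, Matrix.map_apply, quotientMap_apply]
  have e3 : (3 : C(Circle, ℂ)) ζ = 3 := rfl
  have hpζ : p ζ = (ζ : ℂ) * (w + (w : ℂ)⁻¹) + (ζ : ℂ)⁻¹ * (w - (w : ℂ)⁻¹) := rfl
  fin_cases i <;> fin_cases j <;>
    simp only [witness, Matrix.of_apply, Matrix.cons_val', Matrix.cons_val_zero,
      Matrix.cons_val_one, Matrix.cons_val_fin_one, Fin.zero_eta, Fin.mk_one, evalAt_trig,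
      map_add, map_smul, map_zero, entry_mk_zero_zero, entry_mk_zero_one, entry_mk_one_zero,
      entry_mk_one_one, smul_eq_mul, e3, hpζ, ContinuousMap.star_apply, Complex.star_def, map_mul,
      map_sub, map_inv₀, hc, inv_inv] <;> ring

theorem isPos_map_inducedMap_witness {D : Type*} [CStarAlgebra D]
    (𝒟 : AdmissibleCover SZ (1 : Multiplicative ℤ →* SZ.Aut) D)
    {K : Type*} [NormedAddCommGroup K] [InnerProductSpace ℂ K] [CompleteSpace K]
    (τ : FaithfulRep D K) : (𝒟.crossedProduct τ zSet_isGeneratingSet).IsPos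
      ((witness 𝒞 π).map (𝒞.inducedMap π 𝒟 τ zSet_isGeneratingSet quotientMap)) := by
  rw [AdmissibleCover.isPos_iff_forall_evalAt]
  intro w
  convert isPos_witness 𝒞 π w using 1
  ext1 i j
  simp only [Matrix.map_apply, AdmissibleCover.evalAt_inducedMap]

/-- The value of a lift at `±1` and at `±i` cannot be positive. -/
theorem false_of_quadratic_nonneg (E : Circle → Fin 2 → Fin 2 → Fin 2 → Fin 2 → ℂ)
    (hq : ∀ (w : Circle) (v : Fin 2 → Fin 2 → ℂ),
      0 ≤ ∑ i, ∑ j, ∑ a, ∑ b, star (v i a) * E w i j a b * v j b)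
    (hsum : ∀ i j a b, E 1 i j a b + E (-1) i j a b = E circleI i j a b + E (-circleI) i j a b)
    (hd : ∀ w, E w 0 0 0 0 + E w 0 0 1 1 = 7) (hd' : ∀ w, E w 1 1 0 0 + E w 1 1 1 1 = 7)
    (h01 : ∀ w : Circle, E w 0 1 0 1 = 2 * (w : ℂ) + 2 * (w : ℂ)⁻¹ ∧
      E w 0 1 1 0 = 2 * (w : ℂ) - 2 * (w : ℂ)⁻¹)
    (h10 : ∀ w : Circle, E w 1 0 0 1 = 2 * (w : ℂ)⁻¹ - 2 * (w : ℂ) ∧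
      E w 1 0 1 0 = 2 * (w : ℂ) + 2 * (w : ℂ)⁻¹) : False := by
  have hI : (circleI : ℂ) = Complex.I := rfl
  -- Each vector selects the off-diagonal pair that survives at its point, with phases making the
  -- cross terms equal to `-8`. At `±1` the remaining terms are the `(0,0)` entry of the first
  -- diagonal block and the `(1,1)` entry of the second; at `±i` they are the complementary ones.
  have k1 := hq 1 ![![1, 0], ![0, -1]]
  have k2 := hq (-1) ![![1, 0], ![0, 1]]
  have k3 := hq circleI ![![0, 1], ![Complex.I, 0]]
  have k4 := hq (-circleI) ![![0, 1], ![-Complex.I, 0]]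
  simp only [Fin.sum_univ_two, Matrix.cons_val_zero, Matrix.cons_val_one, Matrix.cons_val_fin_one,
    map_zero, map_one, map_neg, zero_mul, mul_zero, add_zero, zero_add, one_mul, mul_one,
    neg_mul, mul_neg, neg_neg, h01, h10, Circle.coe_one, Circle.coe_neg, hI, inv_one, inv_neg,
    Complex.inv_I, Complex.star_def, Complex.conj_I] at k1 k2 k3 k4
  have k := add_nonneg (add_nonneg k1 k2) (add_nonneg k3 k4)
  have hval : (0 : ℂ) ≤ -4 := by
    refine k.trans_eq ?_
    -- Moving the diagonal terms from `±1` to `±i` completes four traces, and `4 * 7 - 4 * 8 = -4`.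
    linear_combination hsum 0 0 0 0 + hsum 1 1 1 1 + hd circleI + hd (-circleI) + hd' circleI +
      hd' (-circleI) + (16 - E circleI 1 1 0 0 - E (-circleI) 1 1 0 0) * Complex.I_sq
  norm_num at hval

theorem not_isCompleteQuotientMap_inducedMap {D : Type*} [CStarAlgebra D]
    (𝒟 : AdmissibleCover SZ (1 : Multiplicative ℤ →* SZ.Aut) D)
    {K : Type*} [NormedAddCommGroup K] [InnerProductSpace ℂ K] [CompleteSpace K]
    (τ : FaithfulRep D K) : ¬ OpSystem.IsCompleteQuotientMap
      (𝒞.inducedMap π 𝒟 τ zSet_isGeneratingSet quotientMap) := by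
  intro h
  -- With perturbation `ε` each diagonal block has trace `6 + 2ε`, and the obstruction needs this to
  -- be below 8; `ε = 1/2` gives 7.
  obtain ⟨Y, hY, hYW⟩ := h.exists_lift (isPos_map_inducedMap_witness 𝒞 π 𝒟 τ)
    (show (0 : ℝ) < 1 / 2 by norm_num)
  rw [AdmissibleCover.isPos_iff_forall_evalAt] at hY
  have hev : ∀ i j w, quotientMap (𝒞.evalAt π zSet_isGeneratingSet w (Y i j)) =
      quotientMap (𝒞.evalAt π zSet_isGeneratingSet w (witness 𝒞 π i j) +
        if i = j then ((1 / 2 : ℝ) : ℂ) • MTwo.unit else 0) := by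
    intro i j w
    rw [𝒞.evalAt_eq_of_inducedMap_eq π zSet_isGeneratingSet 𝒟 τ quotientMap w (hYW i j), map_add]
    congr 1
    split_ifs
    · rw [map_smul, map_smul, AdmissibleCover.evalAt_unit, isUCP_quotientMap.map_unit]
    · rw [map_zero, map_zero]
  simp only [quotientMap_eq_iff] at hev
  refine false_of_quadratic_nonneg
    (fun w i j a b => entry a b (𝒞.evalAt π zSet_isGeneratingSet w (Y i j)))
    (fun w v => IsPosMatrix.iff_quadratic_nonneg.1 (hY w) v) ?_ ?_ ?_ ?_ ?_
  · intro i j a b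
    simp only [← map_add, evalAt_add_evalAt_neg]
  · intro w
    refine (hev 0 0 w).1.trans ?_
    simp [witness, evalAt_trig, unit_eq_mk]
    norm_num
  · intro w
    refine (hev 1 1 w).1.trans ?_
    simp [witness, evalAt_trig, unit_eq_mk]
    norm_num
  · intro w
    refine ⟨(hev 0 1 w).2.1.trans ?_, (hev 0 1 w).2.2.trans ?_⟩ <;>
      simp [witness, evalAt_trig] <;> ring
  · intro w
    refine ⟨(hev 1 0 w).2.1.trans ?_, (hev 1 0 w).2.2.trans ?_⟩ <;>
      simp [witness, evalAt_trig] <;> ring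

end

end SZ

theorem mainTheorem12 :
    ∃ φ : MTwo →ₗ[ℂ] SZ,
      OpSystem.IsEquivariant (1 : Multiplicative ℤ →* MTwo.Aut) (1 : Multiplicative ℤ →* SZ.Aut) φ ∧
      OpSystem.IsCompleteQuotientMap φ ∧
      ∀ (C : Type*) [CStarAlgebra C]
        (𝒞 : AdmissibleCover MTwo (1 : Multiplicative ℤ →* MTwo.Aut) C)
        (H : Type*) [NormedAddCommGroup H] [InnerProductSpace ℂ H] [CompleteSpace H]
        (π : FaithfulRep C H)
        (D : Type*) [CStarAlgebra D]
        (𝒟 : AdmissibleCover SZ (1 : Multiplicative ℤ →* SZ.Aut) D)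
        (K : Type*) [NormedAddCommGroup K] [InnerProductSpace ℂ K] [CompleteSpace K]
        (τ : FaithfulRep D K),
        OpSystem.IsUCP (𝒞.inducedMap π 𝒟 τ zSet_isGeneratingSet φ) ∧
        ¬ OpSystem.IsCompleteQuotientMap (𝒞.inducedMap π 𝒟 τ zSet_isGeneratingSet φ) :=
  ⟨SZ.quotientMap, fun _ _ => rfl, SZ.isCompleteQuotientMap_quotientMap,
    fun _ _ 𝒞 _ _ _ _ π _ _ 𝒟 _ _ _ _ τ =>
      ⟨𝒞.isUCP_inducedMap π zSet_isGeneratingSet 𝒟 τ SZ.isUCP_quotientMap,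
        SZ.not_isCompleteQuotientMap_inducedMap 𝒞 π 𝒟 τ⟩⟩
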